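/- Let $(W,S)$ be a 3-complete Coxeter system, i.e. $S$ is finite and the order $m(s,s')$ of $ss'$ is $3$ for all distinct $s,s'\in S$. Let $\ell$ be the length function, $e$ the identity, $T=\{wsw^{-1}: w\in W, s\in S\}$ the set of reflections, and $\le$ the Bruhat order; for $u,v\in W$ let $(u,v)=\{x\in W: u<x<v\}$, and let $B(u,v)$ be the set of all directed paths $\Delta=(u=x_0\to x_1\to\cdots\to x_{n+1}=v)$ in the Bruhat graph, whose edges are $x\to tx$ with $t\in T$ and $\ell(x)<\ell(tx)$. A reflection ordering is a (strict) total order $\prec$ on the set $\Phi^+$ of positive roots (of the geometric representation of $W$) such that $\alpha\prec c_1\alpha+c_2\beta\prec\beta$ whenever $\alpha,\beta,c_1\alpha+c_2\beta\in\Phi^+$, $c_1,c_2>0$ and $\alpha\prec\beta$; it is transferred to $T$ by the canonical bijection between $\Phi^+$ and $T$. Given a reflection ordering $\prec$ and a path $\Delta$ as above, put $t_i=x_{i-1}^{-1}x_i\in T$, and let $m_\prec(\Delta)\in\mathbb Z\langle a,b\rangle$ be the product of $n$ factors, the $i$-th one being $a$ if $t_i\prec t_{i+1}$ and $b$ otherwise.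 The complete $cd$-index of $[u,v]$ is $$\tilde\Psi_{u,v}=\sum_{\Delta\in B(u,v)}m_\prec(\Delta)\in\mathbb Z\langle a,b\rangle .$$ Let $c=a+b$ and $d=ab+ba$. Reflection orderings of $W$ exist and, for all $v\in W$ with $v\ne e$ and all $s\in S$ with $s\not\le v$, $$\tilde\Psi_{s,svs}=\tilde\Psi_{e,v}\cdot c+\sum_{x\in(e,v)}\tilde\Psi_{e,x}\cdot d\cdot\tilde\Psi_{x,v},$$ where each complete $cd$-index in the identity may be computed with an arbitrary reflection ordering, chosen separately for each interval. -/

import Mathlib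

noncomputable section

/-- A Coxeter matrix is 3-complete if all its off-diagonal entries are equal to 3. -/
def CoxeterMatrix.IsThreeComplete {B : Type*} (M : CoxeterMatrix B) : Prop :=
  ∀ i j : B, i ≠ j → M i j = 3

namespace CoxeterMatrix

variable {B : Type*} (M : CoxeterMatrix B)

/-- The linear form `x ↦ 2 ⟨α_i, x⟩` on the root space with basis `(α_j)`, where
`⟨α_i, α_j⟩ = - cos (π / m(i,j))`. When `m(i,j) = ∞`, encoded as `M i j = 0`, the quotient
`π / 0` is `0` in Lean, so that `⟨α_i, α_j⟩ = -1`, as usual. -/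
def simpleCoroot (i : B) : Module.Dual ℝ (B →₀ ℝ) :=
  Finsupp.linearCombination ℝ (fun j : B => -2 * Real.cos (Real.pi / (M i j : ℝ)))

/-- The simple root `α_i`. -/
def simpleRoot (i : B) : B →₀ ℝ := Finsupp.single i 1

theorem simpleCoroot_simpleRoot (i j : B) :
    M.simpleCoroot i (simpleRoot j) = -2 * Real.cos (Real.pi / (M i j : ℝ)) := by
  simp [simpleCoroot, simpleRoot]

theorem simpleCoroot_self (i : B) : M.simpleCoroot i (simpleRoot i) = 2 := by
  simp [simpleCoroot_simpleRoot]

/-- The reflection `x ↦ x - 2 ⟨α_i, x⟩ α_i` of the root space. -/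
def simpleReflection (i : B) : (B →₀ ℝ) ≃ₗ[ℝ] (B →₀ ℝ) :=
  Module.reflection (M.simpleCoroot_self i)

open Polynomial.Chebyshev in
theorem isLiftable_simpleReflection : M.IsLiftable M.simpleReflection := by
  intro i j
  by_cases hij : i = j
  · subst hij
    rw [M.diagonal, pow_one]
    exact LinearEquiv.ext (Module.involutive_reflection (M.simpleCoroot_self i))
  have h1 : M i j ≠ 1 := M.off_diagonal i j hij
  have hx := M.simpleCoroot_simpleRoot i j
  have hy := M.simpleCoroot_simpleRoot j i
  rw [M.symmetric j i] at hy
  ext1 z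
  by_cases h2 : M i j = 2
  · rw [h2] at hx hy ⊢
    have hx' : M.simpleCoroot i (simpleRoot j) = 0 := by rw [hx]; simp
    have hy' : M.simpleCoroot j (simpleRoot i) = 0 := by rw [hy]; simp
    simp [simpleReflection, pow_two, Module.reflection_apply, hx', hy', simpleCoroot_self]
    module
  by_cases h0 : M i j = 0
  · rw [h0, pow_zero]
  obtain ⟨m, hm⟩ : ∃ m, M i j = m := ⟨_, rfl⟩
  rw [hm] at h0 h1 h2 hx hy ⊢
  have h3 : 3 ≤ m := by omega
  have hm0 : (m : ℝ) ≠ 0 := by positivity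
  have ht : 2 * Real.cos (2 * Real.pi / m) =
      M.simpleCoroot i (simpleRoot j) * M.simpleCoroot j (simpleRoot i) - 2 := by
    rw [hx, hy, mul_div_assoc, Real.cos_two_mul]; ring
  have hsin : Real.sin (2 * Real.pi / m) ≠ 0 := by
    apply ne_of_gt
    apply Real.sin_pos_of_pos_of_lt_pi (by positivity)
    rw [div_lt_iff₀ (by positivity)]
    have : (3 : ℝ) ≤ m := by exact_mod_cast h3
    nlinarith [Real.pi_pos]
  have hS (n : ℤ) := S_two_mul_real_cos (2 * Real.pi / m) n
  rw [simpleReflection, simpleReflection,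
    Module.reflection_mul_reflection_pow_apply _ _ m z _ ht]
  obtain ⟨k, hk | hk⟩ := m.even_or_odd'
  · have e1 : ((m : ℤ) - 2) / 2 = k - 1 := by omega
    have e2 : ((m : ℤ) - 1) / 2 = k - 1 := by omega
    have : (S ℝ ((k : ℤ) - 1)).eval (2 * Real.cos (2 * Real.pi / m)) = 0 := by
      have := hS (k - 1)
      rw [show (((((k : ℤ) - 1 : ℤ) : ℝ) + 1) * (2 * Real.pi / m)) = Real.pi by
        have : (m : ℝ) = 2 * k := by exact_mod_cast hk
        rw [eq_comm]; push_cast; field_simp; linarith, Real.sin_pi] at this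
      exact (mul_eq_zero.1 this).resolve_right hsin
    rw [e1, e2, this]
    simp
  · have e1 : ((m : ℤ) - 1) / 2 = k := by omega
    have e2 : ((m : ℤ) - 2) / 2 = k - 1 := by omega
    have e3 : ((m : ℤ) - 3) / 2 = k - 1 := by omega
    have e4 : (m : ℤ) / 2 = k := by omega
    have : (S ℝ (k : ℤ)).eval (2 * Real.cos (2 * Real.pi / m)) +
        (S ℝ ((k : ℤ) - 1)).eval (2 * Real.cos (2 * Real.pi / m)) = 0 := by
      have a := hS k
      have b := hS (k - 1)
      have hmk : (m : ℝ) = 2 * k + 1 := by exact_mod_cast hk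
      rw [show (((((k : ℤ) - 1 : ℤ) : ℝ) + 1) * (2 * Real.pi / m)) =
        2 * Real.pi - (((k : ℤ) : ℝ) + 1) * (2 * Real.pi / m) by
          push_cast; field_simp; rw [hmk]; ring, Real.sin_two_pi_sub] at b
      refine (mul_eq_zero.1 (?_ : _ * Real.sin (2 * Real.pi / m) = 0)).resolve_right hsin
      rw [add_mul, a, b]; ring
    rw [e1, e2, e3, e4, this]
    simp

end CoxeterMatrix

namespace CoxeterSystem

variable {B W : Type*} [Group W] {M : CoxeterMatrix B} (cs : CoxeterSystem M W)

/-- The geometric representation of `W` on the root space. -/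
def geometricRep : W →* ((B →₀ ℝ) ≃ₗ[ℝ] (B →₀ ℝ)) :=
  cs.lift ⟨M.simpleReflection, M.isLiftable_simpleReflection⟩

/-- `β = w(α_i)` is a positive root (a root with nonnegative coordinates) and `t = w s_i w⁻¹` is
the reflection that corresponds to it. -/
def IsPositiveRootOf (t : W) (β : B →₀ ℝ) : Prop :=
  (∃ (w : W) (i : B), t = w * cs.simple i * w⁻¹ ∧
    β = cs.geometricRep w (CoxeterMatrix.simpleRoot i)) ∧ 0 ≤ β

/-- `prec` is (the transfer to reflections of) a reflection ordering: it is a strict total order on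
the set of reflections, and if the positive root of `t` is a positive linear combination of the
positive roots of `t₁` and `t₂`, where `t₁` precedes `t₂`, then `t` lies strictly between `t₁` and
`t₂`. The values of `prec` outside the set of reflections play no role. -/
structure IsReflectionOrdering (prec : W → W → Prop) : Prop where
  irrefl : ∀ t, cs.IsReflection t → ¬ prec t t
  trans : ∀ t₁ t₂ t₃, cs.IsReflection t₁ → cs.IsReflection t₂ → cs.IsReflection t₃ →
    prec t₁ t₂ → prec t₂ t₃ → prec t₁ t₃
  total : ∀ t₁ t₂, cs.IsReflection t₁ → cs.IsReflection t₂ → t₁ ≠ t₂ →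
    prec t₁ t₂ ∨ prec t₂ t₁
  between : ∀ (t₁ t₂ t : W) (β₁ β₂ β : B →₀ ℝ) (c₁ c₂ : ℝ),
    cs.IsPositiveRootOf t₁ β₁ → cs.IsPositiveRootOf t₂ β₂ → cs.IsPositiveRootOf t β →
    0 < c₁ → 0 < c₂ → β = c₁ • β₁ + c₂ • β₂ → prec t₁ t₂ → prec t₁ t ∧ prec t t₂

/-- `x → y` is an edge of the Bruhat graph. -/
def BruhatEdge (x y : W) : Prop :=
  ∃ t, cs.IsReflection t ∧ y = t * x ∧ cs.length x < cs.length y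

/-- The Bruhat order on `W`. -/
def BruhatLE (x y : W) : Prop := Relation.ReflTransGen cs.BruhatEdge x y

/-- The strict Bruhat order on `W`. -/
def BruhatLT (x y : W) : Prop := cs.BruhatLE x y ∧ x ≠ y

/-- A directed path from `u` to `v` in the Bruhat graph, given as its list of vertices. -/
def IsBruhatPath (u v : W) (Δ : List W) : Prop :=
  Δ.head? = some u ∧ Δ.getLast? = some v ∧ Δ.IsChain cs.BruhatEdge

theorem BruhatLE.length_le {x y : W} (h : cs.BruhatLE x y) : cs.length x ≤ cs.length y := by
  induction h with
  | refl => exact le_rfl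
  | tail _ h ih => obtain ⟨t, _, _, h⟩ := h; omega

theorem finite_length_le [Finite B] (n : ℕ) : {w : W | cs.length w ≤ n}.Finite := by
  refine ((List.finite_length_le B n).image cs.wordProd).subset ?_
  intro w hw
  obtain ⟨ω, hω, rfl⟩ := cs.exists_isReduced w
  exact ⟨ω, by simpa [← hω.eq] using hw, rfl⟩

theorem finite_bruhatIoo [Finite B] (u v : W) :
    {x : W | cs.BruhatLT u x ∧ cs.BruhatLT x v}.Finite :=
  (cs.finite_length_le (cs.length v)).subset fun _ hx => hx.2.1.length_le

theorem finite_bruhatPaths [Finite B] (u v : W) : {Δ : List W | cs.IsBruhatPath u v Δ}.Finite := by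
  classical
  let F : Finset W := (cs.finite_length_le (cs.length v)).toFinset
  have hfin : {Δ : List W | (∀ x ∈ Δ, x ∈ F) ∧ Δ.Nodup}.Finite := by
    refine ((List.finite_length_le F F.card).image (List.map Subtype.val)).subset ?_
    rintro Δ ⟨h1, h2⟩
    refine ⟨Δ.attach.map fun x => ⟨x.1, h1 x.1 x.2⟩, ?_, by simp [Function.comp_def]⟩
    have : Δ.toFinset.card ≤ F.card := Finset.card_le_card fun x hx => h1 x (by simpa using hx)
    simpa [List.toFinset_card_of_nodup h2] using this
  refine hfin.subset ?_
  rintro Δ ⟨_, hlast, hch⟩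
  have hlt : Δ.Pairwise (fun x y => cs.length x < cs.length y) := by
    have : Δ.IsChain (fun x y => cs.length x < cs.length y) :=
      hch.imp fun x y ⟨_, _, _, h⟩ => h
    have : IsTrans W (fun x y => cs.length x < cs.length y) := ⟨fun _ _ _ h h' => h.trans h'⟩
    exact List.isChain_iff_pairwise.1 ‹_›
  refine ⟨fun x hx => ?_, hlt.imp fun h e => by simp [e] at h⟩
  obtain ⟨l, rfl⟩ := List.getLast?_eq_some_iff.1 hlast
  rw [List.pairwise_append] at hlt
  simp only [List.mem_append, List.mem_singleton] at hx
  rcases hx with hx | rfl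
  · simpa [F] using (hlt.2.2 x hx v (by simp)).le
  · simp [F]

/-- The open Bruhat interval `(u, v)`. -/
def bruhatIoo [Finite B] (u v : W) : Finset W := (cs.finite_bruhatIoo u v).toFinset

/-- The set `B(u, v)` of all directed paths from `u` to `v` in the Bruhat graph. -/
def bruhatPaths [Finite B] (u v : W) : Finset (List W) := (cs.finite_bruhatPaths u v).toFinset

end CoxeterSystem

namespace CompleteCD

/-- The ring `ℤ⟨a, b⟩` of noncommutative polynomials in two variables. -/
abbrev Poly : Type := FreeAlgebra ℤ (Fin 2)

/-- The variable `a`. -/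
def a : Poly := FreeAlgebra.ι ℤ 0

/-- The variable `b`. -/
def b : Poly := FreeAlgebra.ι ℤ 1

/-- `c = a + b`. -/
def c : Poly := a + b

/-- `d = ab + ba`. -/
def d : Poly := a * b + b * a

open Classical in
/-- The monomial of a path `x₀ → x₁ → ⋯ → xₙ₊₁`, with labels `tᵢ = xᵢ₋₁⁻¹ xᵢ`: the product of `n`
factors, the `i`-th one being `a` if `tᵢ` precedes `tᵢ₊₁`, and `b` otherwise. -/
def pathMonomial {W : Type*} [Group W] (prec : W → W → Prop) : List W → Poly
  | x :: y :: z :: l =>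
      (if prec (x⁻¹ * y) (y⁻¹ * z) then a else b) * pathMonomial prec (y :: z :: l)
  | _ => 1

end CompleteCD

/-- The complete `cd`-index of the Bruhat interval `[u, v]`, computed with the reflection ordering
`prec`, as an element of `ℤ⟨a, b⟩`. -/
def CoxeterSystem.completeCDIndex {B W : Type*} [Finite B] [Group W] {M : CoxeterMatrix B}
    (cs : CoxeterSystem M W) (prec : W → W → Prop) (u v : W) : CompleteCD.Poly :=
  ∑ Δ ∈ cs.bruhatPaths u v, CompleteCD.pathMonomial prec Δ

end

/-! Put J = S \ {s}. As s ≰ v, the element v lies in W_J. In the 3-complete case ℓ(sxs) = ℓ(x) + 2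
for every x ≠ e in W_J, and sx = ys with x, y in W_J forces x = y = e. So the paths from s to svs
only meet vertices sx, xs and, for x ≠ e, sxs, with x ≤ v in W_J. The edges between them are copies
of the edges x → y (sx → sy, xs → ys, sxs → sys) and the crossings sx → sxs and xs → sxs with x ≠ e.
A path from s to svs therefore amounts to a path from e to v with a marked vertex x ≠ e, where it
crosses, together with a choice of side.

If t = x⁻¹y, then sx → sy is labelled t, while xs → ys and sxs → sys are labelled sts. The crossings
are labelled s and s(x⁻¹sx)s. Take an ordering for which, for all reflections t, t' of W_J,
conjugation by s preserves the order of t and t', t ≺ s, sts ≺ s, and s(x⁻¹sx)s ≺ sts. Then the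
crossing contributes ab on the side sW_J and ba on the side W_J s (only a and b if x = v), and the
other factors are those of the two pieces of the path in [e, v]. Summation gives `c` at x = v and
`d` elsewhere. Such an ordering (`isAdapted_lexPrec`) is the lexicographic order of the positive
roots scaled to height 1, with the coordinate of α_s read first.

The orderings in the statement are arbitrary, so the index must not depend on them
(`completeCDIndex_independent`). Replace each a by (a - b) + b: cutting a path at the chosen b's
leaves increasing segments, so the index is determined by the generating functions of increasing
paths. These are independent of the ordering (`ascPoly_independent`): for a right descent s of v,
any ordering can be changed into one with s last without changing the generating function, and then
a recursion leads from v to vs. -/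

noncomputable section

/-! ### Geometric representation, positive roots and strong exchange -/

namespace CoxeterMatrix

variable {B : Type*} (M : CoxeterMatrix B)

/-- Twice the bilinear form of the geometric representation. -/
def rootForm : (B →₀ ℝ) →ₗ[ℝ] Module.Dual ℝ (B →₀ ℝ) :=
  Finsupp.linearCombination ℝ M.simpleCoroot

@[simp]
theorem rootForm_simpleRoot (i : B) : M.rootForm (simpleRoot i) = M.simpleCoroot i := by
  simp [rootForm, simpleRoot]

theorem rootForm_comm (x y : B →₀ ℝ) : M.rootForm x y = M.rootForm y x := by
  have h : M.rootForm = M.rootForm.flip := by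
    ext i j
    have := M.simpleCoroot_simpleRoot i j
    have := M.simpleCoroot_simpleRoot j i
    have := M.symmetric i j
    simp_all [rootForm, simpleRoot]
  exact congrArg (fun f => f x y) h

theorem rootForm_apply_simpleRoot (x : B →₀ ℝ) (i : B) :
    M.rootForm x (simpleRoot i) = M.simpleCoroot i x := by
  rw [rootForm_comm, rootForm_simpleRoot]

theorem simpleReflection_apply (i : B) (x : B →₀ ℝ) :
    M.simpleReflection i x = x - M.simpleCoroot i x • simpleRoot i :=
  Module.reflection_apply ..

theorem rootForm_simpleReflection (i : B) (x y : B →₀ ℝ) :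
    M.rootForm (M.simpleReflection i x) (M.simpleReflection i y) = M.rootForm x y := by
  simp only [simpleReflection_apply, map_sub, map_smul, LinearMap.sub_apply, LinearMap.smul_apply,
    rootForm_simpleRoot, rootForm_apply_simpleRoot, simpleCoroot_self, smul_eq_mul]
  ring

theorem simpleRoot_nonneg (i : B) : (0 : B →₀ ℝ) ≤ simpleRoot i := by
  classical
  intro j
  simp only [simpleRoot, Finsupp.single_apply, Finsupp.coe_zero, Pi.zero_apply]
  split_ifs <;> norm_num

theorem simpleRoot_ne_zero (i : B) : (simpleRoot i : B →₀ ℝ) ≠ 0 := by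
  simp [simpleRoot]

variable {M} in
theorem IsThreeComplete.simpleCoroot_simpleRoot (hM : M.IsThreeComplete) {i j : B} (h : i ≠ j) :
    M.simpleCoroot i (simpleRoot j) = -1 := by
  rw [CoxeterMatrix.simpleCoroot_simpleRoot, hM i j h]
  norm_num [Real.cos_pi_div_three]

end CoxeterMatrix

namespace CoxeterSystem

open CoxeterMatrix

variable {B W : Type*} [Group W] {M : CoxeterMatrix B} (cs : CoxeterSystem M W)

theorem geometricRep_simple (i : B) : cs.geometricRep (cs.simple i) = M.simpleReflection i :=
  cs.lift_apply_simple M.isLiftable_simpleReflection i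

theorem geometricRep_mul_apply (w w' : W) (x : B →₀ ℝ) :
    cs.geometricRep (w * w') x = cs.geometricRep w (cs.geometricRep w' x) := by
  rw [map_mul]; rfl

theorem geometricRep_one_apply (x : B →₀ ℝ) : cs.geometricRep 1 x = x := by
  rw [map_one]; rfl

theorem geometricRep_apply_inv_apply (w : W) (x : B →₀ ℝ) :
    cs.geometricRep w (cs.geometricRep w⁻¹ x) = x := by
  rw [← geometricRep_mul_apply, mul_inv_cancel, geometricRep_one_apply]

theorem geometricRep_simple_apply (i : B) (x : B →₀ ℝ) :
    cs.geometricRep (cs.simple i) x = x - M.simpleCoroot i x • simpleRoot i := by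
  rw [geometricRep_simple, simpleReflection_apply]

theorem geometricRep_simple_self (i : B) :
    cs.geometricRep (cs.simple i) (simpleRoot i) = - simpleRoot i := by
  rw [geometricRep_simple_apply, simpleCoroot_self]; module

theorem geometricRep_simple_simple (i : B) (x : B →₀ ℝ) :
    cs.geometricRep (cs.simple i) (cs.geometricRep (cs.simple i) x) = x := by
  rw [← geometricRep_mul_apply, simple_mul_simple_self, geometricRep_one_apply]

theorem geometricRep_simple_apply_of_ne {i j : B} (h : j ≠ i) (x : B →₀ ℝ) :
    cs.geometricRep (cs.simple i) x j = x j := by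
  simp [geometricRep_simple_apply, simpleRoot, h.symm]

theorem rootForm_geometricRep (w : W) (x y : B →₀ ℝ) :
    M.rootForm (cs.geometricRep w x) (cs.geometricRep w y) = M.rootForm x y := by
  induction w using cs.simple_induction_left generalizing x y with
  | one => simp only [geometricRep_one_apply]
  | mul_simple_left w i ih =>
    rw [geometricRep_mul_apply, geometricRep_mul_apply, geometricRep_simple,
      rootForm_simpleReflection, ih]

theorem geometricRep_conj_simple_apply (w : W) (i : B) (x : B →₀ ℝ) :
    cs.geometricRep (w * cs.simple i * w⁻¹) x =
      x - M.rootForm (cs.geometricRep w (simpleRoot i)) x • cs.geometricRep w (simpleRoot i) := by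
  rw [geometricRep_mul_apply, geometricRep_mul_apply, geometricRep_simple_apply, map_sub, map_smul,
    geometricRep_apply_inv_apply, ← rootForm_simpleRoot, ← cs.rootForm_geometricRep w,
    geometricRep_apply_inv_apply]

theorem geometricRep_simple_simpleRoot (hM : M.IsThreeComplete) {i j : B} (h : i ≠ j) :
    cs.geometricRep (cs.simple i) (simpleRoot j) = simpleRoot i + simpleRoot j := by
  rw [geometricRep_simple_apply, hM.simpleCoroot_simpleRoot h]; module

theorem simple_braid (hM : M.IsThreeComplete) {i j : B} (h : i ≠ j) :
    cs.simple i * cs.simple j * cs.simple i = cs.simple j * cs.simple i * cs.simple j := by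
  have h1 := cs.simple_mul_simple_pow i j
  rw [hM i j h, pow_succ, pow_two, mul_eq_one_iff_eq_inv, mul_inv_rev, inv_simple, inv_simple] at h1
  calc _ = (cs.simple i * cs.simple j * (cs.simple i * cs.simple j)) * cs.simple j := by
        simp [mul_assoc]
    _ = _ := by rw [h1]

/-- Write w = w₁ s_j. As m = 3, w α_i = w₁ α_j + w₁ α_i, and induction applies unless s_i is a right
descent of w₁. In that case w = w₂ s_i s_j and w α_i = w₂ α_j. -/
theorem geometricRep_simpleRoot_nonneg (hM : M.IsThreeComplete) (w : W) (i : B)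
    (h : cs.length w < cs.length (w * cs.simple i)) : 0 ≤ cs.geometricRep w (simpleRoot i) := by
  induction hn : cs.length w using Nat.strong_induction_on generalizing w i with
  | _ n ih =>
  subst hn
  by_cases hw : w = 1
  · subst hw
    rw [geometricRep_one_apply]
    exact simpleRoot_nonneg i
  obtain ⟨j, hj⟩ := cs.exists_rightDescent_of_ne_one hw
  have hij : j ≠ i := by rintro rfl; exact absurd hj (by unfold IsRightDescent; omega)
  obtain ⟨w₁, rfl⟩ : ∃ w₁, w = w₁ * cs.simple j := ⟨w * cs.simple j, by simp⟩
  rw [IsRightDescent, simple_mul_simple_cancel_right] at hj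
  rcases cs.length_mul_simple w₁ j with hl | hl <;> [skip; omega]
  rcases cs.length_mul_simple w₁ i with h1 | h1
  · rw [geometricRep_mul_apply, cs.geometricRep_simple_simpleRoot hM hij, map_add]
    exact add_nonneg (ih _ hj w₁ j hj rfl) (ih _ hj w₁ i (by omega) rfl)
  obtain ⟨w₂, rfl⟩ : ∃ w₂, w₁ = w₂ * cs.simple i := ⟨w₁ * cs.simple i, by simp⟩
  rw [simple_mul_simple_cancel_right] at h1
  have e : cs.geometricRep (w₂ * cs.simple i * cs.simple j) (simpleRoot i) =
      cs.geometricRep w₂ (simpleRoot j) := by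
    rw [geometricRep_mul_apply, geometricRep_mul_apply, cs.geometricRep_simple_simpleRoot hM hij,
      map_add, geometricRep_simple_self, cs.geometricRep_simple_simpleRoot hM hij.symm]
    congr 1; abel
  rw [e]
  refine ih _ (by omega) w₂ j ?_ rfl
  -- Otherwise w₂ = w₃ s_j, and by the braid relation w s_i = w₃ s_i s_j is shorter than w.
  by_contra hlt
  rcases cs.length_mul_simple w₂ j with h2 | h2
  · omega
  obtain ⟨w₃, rfl⟩ : ∃ w₃, w₂ = w₃ * cs.simple j := ⟨w₂ * cs.simple j, by simp⟩
  rw [simple_mul_simple_cancel_right] at h2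
  have e2 : w₃ * cs.simple j * cs.simple i * cs.simple j * cs.simple i =
      w₃ * cs.simple i * cs.simple j := by
    have := cs.simple_braid hM hij
    calc _ = w₃ * (cs.simple j * cs.simple i * cs.simple j) * cs.simple i := by group
      _ = _ := by rw [this]; simp [← mul_assoc]
  rw [e2] at h
  have := cs.length_mul_simple (w₃ * cs.simple i) j
  have := cs.length_mul_simple w₃ i
  omega

theorem geometricRep_simpleRoot_nonpos (hM : M.IsThreeComplete) (w : W) (i : B)
    (h : cs.length (w * cs.simple i) < cs.length w) : cs.geometricRep w (simpleRoot i) ≤ 0 := by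
  have := cs.geometricRep_simpleRoot_nonneg hM (w * cs.simple i) i (by simpa using h)
  rw [geometricRep_mul_apply, geometricRep_simple_self, map_neg] at this
  exact neg_nonneg.1 this

theorem geometricRep_simpleRoot_nonneg_or_nonpos (hM : M.IsThreeComplete) (w : W) (i : B) :
    0 ≤ cs.geometricRep w (simpleRoot i) ∨ cs.geometricRep w (simpleRoot i) ≤ 0 :=
  (cs.length_mul_simple_ne w i).lt_or_gt.symm.imp (cs.geometricRep_simpleRoot_nonneg hM w i)
    (cs.geometricRep_simpleRoot_nonpos hM w i)

theorem geometricRep_simpleRoot_ne_zero (w : W) (i : B) :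
    cs.geometricRep w (simpleRoot i) ≠ 0 := by
  simp [simpleRoot_ne_zero]

/-- A nontrivial element sends the simple root of a right descent to a negative root. -/
theorem geometricRep_injective (hM : M.IsThreeComplete) : Function.Injective cs.geometricRep := by
  rw [injective_iff_map_eq_one]
  intro w hw
  by_contra h
  obtain ⟨i, hi⟩ := cs.exists_rightDescent_of_ne_one h
  have := cs.geometricRep_simpleRoot_nonpos hM w i hi
  rw [hw] at this
  exact simpleRoot_ne_zero i (le_antisymm this (simpleRoot_nonneg i))

variable {cs}

theorem IsPositiveRootOf.nonneg {t : W} {β : B →₀ ℝ} (h : cs.IsPositiveRootOf t β) : 0 ≤ β := h.2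

theorem IsPositiveRootOf.isReflection {t : W} {β : B →₀ ℝ} (h : cs.IsPositiveRootOf t β) :
    cs.IsReflection t := by
  obtain ⟨⟨w, i, rfl, -⟩, -⟩ := h
  exact ⟨w, i, rfl⟩

theorem IsPositiveRootOf.ne_zero {t : W} {β : B →₀ ℝ} (h : cs.IsPositiveRootOf t β) : β ≠ 0 := by
  obtain ⟨⟨w, i, -, rfl⟩, -⟩ := h
  exact cs.geometricRep_simpleRoot_ne_zero w i

theorem IsPositiveRootOf.rootForm_self {t : W} {β : B →₀ ℝ} (h : cs.IsPositiveRootOf t β) :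
    M.rootForm β β = 2 := by
  obtain ⟨⟨w, i, -, rfl⟩, -⟩ := h
  rw [rootForm_geometricRep, rootForm_simpleRoot, simpleCoroot_self]

theorem IsPositiveRootOf.geometricRep_apply {t : W} {β : B →₀ ℝ} (h : cs.IsPositiveRootOf t β)
    (x : B →₀ ℝ) : cs.geometricRep t x = x - M.rootForm β x • β := by
  obtain ⟨⟨w, i, rfl, rfl⟩, -⟩ := h
  rw [geometricRep_conj_simple_apply]

theorem IsPositiveRootOf.geometricRep_self {t : W} {β : B →₀ ℝ} (h : cs.IsPositiveRootOf t β) :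
    cs.geometricRep t β = -β := by
  rw [h.geometricRep_apply, h.rootForm_self]; module

/-- All roots have the same norm, so the factor is ±1, and positivity excludes -1. -/
theorem IsPositiveRootOf.eq_of_eq_smul {t t' : W} {β β' : B →₀ ℝ} (h : cs.IsPositiveRootOf t β)
    (h' : cs.IsPositiveRootOf t' β') {c : ℝ} (e : β = c • β') : β = β' := by
  have h1 := h.rootForm_self
  rw [e, map_smul, map_smul, LinearMap.smul_apply, h'.rootForm_self, smul_eq_mul, smul_eq_mul] at h1
  have h2 : (c - 1) * (c + 1) = 0 := by linarith
  rcases mul_eq_zero.1 h2 with h2 | h2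
  · rw [e, sub_eq_zero.1 h2, one_smul]
  · rw [eq_neg_of_add_eq_zero_left h2] at e
    refine absurd (le_antisymm ?_ h.nonneg) h.ne_zero
    rw [e, neg_one_smul]
    exact neg_nonpos.2 h'.nonneg

theorem IsPositiveRootOf.unique {t : W} {β β' : B →₀ ℝ} (h : cs.IsPositiveRootOf t β)
    (h' : cs.IsPositiveRootOf t β') : β = β' := by
  refine h.eq_of_eq_smul h' (c := M.rootForm β' β / 2) ?_
  have h1 := h.geometricRep_self
  rw [h'.geometricRep_apply] at h1
  have h2 : (2 : ℝ) • β = M.rootForm β' β • β' := by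
    rw [two_smul, ← sub_eq_zero, ← sub_eq_zero.2 h1]; abel
  rw [div_eq_inv_mul, mul_smul, ← h2, smul_smul]; norm_num

theorem IsPositiveRootOf.reflection_unique (hM : M.IsThreeComplete) {t t' : W} {β : B →₀ ℝ}
    (h : cs.IsPositiveRootOf t β) (h' : cs.IsPositiveRootOf t' β) : t = t' := by
  refine cs.geometricRep_injective hM (LinearEquiv.ext fun x => ?_)
  rw [h.geometricRep_apply, h'.geometricRep_apply]

theorem IsReflection.exists_isPositiveRootOf (hM : M.IsThreeComplete) {t : W}
    (h : cs.IsReflection t) : ∃ β, cs.IsPositiveRootOf t β := by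
  obtain ⟨w, i, rfl⟩ := h
  rcases cs.geometricRep_simpleRoot_nonneg_or_nonpos hM w i with h | h
  · exact ⟨_, ⟨w, i, rfl, rfl⟩, h⟩
  · refine ⟨_, ⟨w * cs.simple i, i, by simp [mul_assoc], rfl⟩, ?_⟩
    rw [geometricRep_mul_apply, geometricRep_simple_self, map_neg]
    exact neg_nonneg.2 h

theorem IsPositiveRootOf.geometricRep_nonneg_or_nonpos (hM : M.IsThreeComplete) {t : W}
    {β : B →₀ ℝ} (h : cs.IsPositiveRootOf t β) (w : W) :
    0 ≤ cs.geometricRep w β ∨ cs.geometricRep w β ≤ 0 := by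
  obtain ⟨⟨w', i, rfl, rfl⟩, -⟩ := h
  rw [← geometricRep_mul_apply]
  exact cs.geometricRep_simpleRoot_nonneg_or_nonpos hM _ i

theorem IsPositiveRootOf.conj {t : W} {β : B →₀ ℝ} (h : cs.IsPositiveRootOf t β) {w : W}
    (hw : 0 ≤ cs.geometricRep w β) :
    cs.IsPositiveRootOf (w * t * w⁻¹) (cs.geometricRep w β) := by
  obtain ⟨⟨w', i, rfl, rfl⟩, -⟩ := h
  exact ⟨⟨w * w', i, by group, by rw [geometricRep_mul_apply]⟩, hw⟩

variable (cs) in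
theorem isPositiveRootOf_simple (i : B) : cs.IsPositiveRootOf (cs.simple i) (simpleRoot i) :=
  ⟨⟨1, i, by simp, by rw [geometricRep_one_apply]⟩, simpleRoot_nonneg i⟩

theorem IsPositiveRootOf.eq_simple (hM : M.IsThreeComplete) {t : W} {β : B →₀ ℝ}
    (h : cs.IsPositiveRootOf t β) {i : B} (hi : ∀ j, j ≠ i → β j = 0) : t = cs.simple i := by
  have e : β = β i • simpleRoot i := by
    ext j
    by_cases hj : j = i
    · subst hj; simp [simpleRoot]
    · simp [simpleRoot, Ne.symm hj, hi j hj]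
  rw [h.eq_of_eq_smul (cs.isPositiveRootOf_simple i) e] at h
  exact h.reflection_unique hM (cs.isPositiveRootOf_simple i)

/-- The reflection s_i only changes the i-th coordinate, so a positive root that it makes negative
is supported at i. -/
theorem IsPositiveRootOf.simple_nonneg (hM : M.IsThreeComplete) {t : W} {β : B →₀ ℝ}
    (h : cs.IsPositiveRootOf t β) {i : B} (hi : t ≠ cs.simple i) :
    0 ≤ cs.geometricRep (cs.simple i) β := by
  rcases h.geometricRep_nonneg_or_nonpos hM (cs.simple i) with h1 | h1
  · exact h1
  · refine absurd (h.eq_simple hM fun j hj => ?_) hi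
    have := h1 j
    rw [cs.geometricRep_simple_apply_of_ne hj] at this
    exact le_antisymm this (h.nonneg j)

theorem IsPositiveRootOf.simple_conj (hM : M.IsThreeComplete) {t : W} {β : B →₀ ℝ}
    (h : cs.IsPositiveRootOf t β) {i : B} (hi : t ≠ cs.simple i) :
    cs.IsPositiveRootOf (cs.simple i * t * cs.simple i) (cs.geometricRep (cs.simple i) β) := by
  simpa using h.conj (h.simple_nonneg hM hi)

/-- Strong exchange. Apply the letters of ω to β from right to left: a letter that turns the image
of β from positive to negative is the reflection of that image, and multiplying by t deletes it. -/
theorem IsPositiveRootOf.exists_eraseIdx (hM : M.IsThreeComplete) {t : W} {β : B →₀ ℝ}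
    (h : cs.IsPositiveRootOf t β) {ω : List B} (hω : cs.geometricRep (cs.wordProd ω) β ≤ 0) :
    ∃ k < ω.length, cs.wordProd ω * t = cs.wordProd (ω.eraseIdx k) := by
  induction ω with
  | nil =>
    rw [wordProd_nil, geometricRep_one_apply] at hω
    exact absurd (le_antisymm hω h.nonneg) h.ne_zero
  | cons i ω ih =>
    rcases h.geometricRep_nonneg_or_nonpos hM (cs.wordProd ω) with h1 | h1
    · have h2 := h.conj h1
      by_cases h3 : cs.wordProd ω * t * (cs.wordProd ω)⁻¹ = cs.simple i
      · refine ⟨0, by simp, ?_⟩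
        rw [mul_inv_eq_iff_eq_mul] at h3
        rw [wordProd_cons, mul_assoc, h3, simple_mul_simple_cancel_left]
        simp
      · rw [wordProd_cons, geometricRep_mul_apply] at hω
        have h4 := le_antisymm hω (h2.simple_nonneg hM h3)
        simp only [LinearEquiv.map_eq_zero_iff] at h4
        exact absurd h4 h.ne_zero
    · obtain ⟨k, hk, e⟩ := ih h1
      exact ⟨k + 1, by simpa using hk, by simp [wordProd_cons, mul_assoc, e]⟩

theorem IsPositiveRootOf.length_mul_lt (hM : M.IsThreeComplete) {t : W} {β : B →₀ ℝ}
    (h : cs.IsPositiveRootOf t β) {w : W} (hw : cs.geometricRep w β ≤ 0) :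
    cs.length (w * t) < cs.length w := by
  obtain ⟨ω, hω, rfl⟩ := cs.exists_isReduced w
  obtain ⟨k, hk, e⟩ := h.exists_eraseIdx hM hw
  rw [e, hω.eq]
  refine (cs.length_wordProd_le _).trans_lt ?_
  rw [List.length_eraseIdx_of_lt hk]
  omega

theorem IsPositiveRootOf.length_lt_mul (hM : M.IsThreeComplete) {t : W} {β : B →₀ ℝ}
    (h : cs.IsPositiveRootOf t β) {w : W} (hw : 0 ≤ cs.geometricRep w β) :
    cs.length w < cs.length (w * t) := by
  have := h.length_mul_lt hM (w := w * t) (by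
    rw [geometricRep_mul_apply, h.geometricRep_self, map_neg]; exact neg_nonpos.2 hw)
  rwa [mul_assoc, h.isReflection.mul_self, mul_one] at this

theorem IsPositiveRootOf.length_lt_mul_iff (hM : M.IsThreeComplete) {t : W} {β : B →₀ ℝ}
    (h : cs.IsPositiveRootOf t β) {w : W} :
    cs.length w < cs.length (w * t) ↔ 0 ≤ cs.geometricRep w β := by
  refine ⟨fun hw => ?_, h.length_lt_mul hM⟩
  refine (h.geometricRep_nonneg_or_nonpos hM w).resolve_right fun h1 => ?_
  have := h.length_mul_lt hM h1
  omega

theorem IsReflection.exists_eraseIdx (hM : M.IsThreeComplete) {t : W} (h : cs.IsReflection t)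
    {ω : List B} (hω : cs.length (cs.wordProd ω * t) < cs.length (cs.wordProd ω)) :
    ∃ k < ω.length, cs.wordProd ω * t = cs.wordProd (ω.eraseIdx k) := by
  obtain ⟨β, hβ⟩ := h.exists_isPositiveRootOf hM
  refine hβ.exists_eraseIdx hM ((hβ.geometricRep_nonneg_or_nonpos hM _).resolve_left fun h1 => ?_)
  have := hβ.length_lt_mul hM h1
  omega

theorem simple_conj_isReflection {t : W} (h : cs.IsReflection t) (i : B) :
    cs.IsReflection (cs.simple i * t * cs.simple i) := by
  simpa using h.conj (cs.simple i)

theorem bruhatEdge_iff {x y : W} :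
    cs.BruhatEdge x y ↔ cs.IsReflection (x⁻¹ * y) ∧ cs.length x < cs.length y := by
  constructor
  · rintro ⟨t, ht, rfl, h⟩
    refine ⟨?_, h⟩
    simpa [mul_assoc] using ht.conj x⁻¹
  · rintro ⟨h1, h2⟩
    exact ⟨y * x⁻¹, by simpa [mul_assoc] using h1.conj x, by simp, h2⟩

theorem BruhatEdge.isReflection {x y : W} (h : cs.BruhatEdge x y) : cs.IsReflection (x⁻¹ * y) :=
  (bruhatEdge_iff.1 h).1

theorem BruhatEdge.length_lt {x y : W} (h : cs.BruhatEdge x y) : cs.length x < cs.length y :=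
  (bruhatEdge_iff.1 h).2

/-- The edge x → xt goes up exactly when xβ is positive, where β is the root of t. Since (xs)(sβ) =
xβ, the direction persists as long as sβ is still positive, that is, t ≠ s. -/
theorem BruhatEdge.mul_simple (hM : M.IsThreeComplete) {x y : W} (h : cs.BruhatEdge x y) {i : B}
    (hi : x⁻¹ * y ≠ cs.simple i) : cs.BruhatEdge (x * cs.simple i) (y * cs.simple i) := by
  obtain ⟨t, rfl⟩ : ∃ t, y = x * t := ⟨x⁻¹ * y, by simp⟩
  rw [inv_mul_cancel_left] at hi
  obtain ⟨ht, hl⟩ := bruhatEdge_iff.1 h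
  rw [inv_mul_cancel_left] at ht
  obtain ⟨β, hβ⟩ := ht.exists_isPositiveRootOf hM
  have h2 := hβ.simple_conj hM hi
  have e : (x * cs.simple i)⁻¹ * (x * t * cs.simple i) = cs.simple i * t * cs.simple i := by
    simp [mul_assoc]
  refine bruhatEdge_iff.2 ⟨by rw [e]; exact simple_conj_isReflection ht i, ?_⟩
  have h3 := h2.length_lt_mul hM (w := x * cs.simple i) (by
    rw [geometricRep_mul_apply, geometricRep_simple_simple]
    exact (hβ.length_lt_mul_iff hM).1 hl)
  simpa [mul_assoc] using h3

end CoxeterSystem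
end

/-! ### Bruhat paths and generating functions of increasing paths -/

noncomputable section

namespace CoxeterSystem

open Classical Polynomial

variable {B W : Type*} [Group W] {M : CoxeterMatrix B} (cs : CoxeterSystem M W)

variable {cs} in
theorem IsBruhatPath.exists_eq_cons {u v : W} {Δ : List W} (h : cs.IsBruhatPath u v Δ) :
    ∃ l, Δ = u :: l := by
  obtain ⟨h, -, -⟩ := h
  cases Δ with
  | nil => simp at h
  | cons x l => simp at h; exact ⟨l, by rw [h]⟩

theorem isBruhatPath_singleton_iff {u v x : W} :
    cs.IsBruhatPath u v [x] ↔ x = u ∧ u = v := by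
  simp only [IsBruhatPath, List.head?_cons, Option.some.injEq, List.getLast?_singleton,
    List.isChain_singleton, and_true]
  grind

theorem isBruhatPath_cons_cons_iff {u v x y : W} {l : List W} :
    cs.IsBruhatPath u v (x :: y :: l) ↔
      x = u ∧ cs.BruhatEdge u y ∧ cs.IsBruhatPath y v (y :: l) := by
  simp only [IsBruhatPath, List.head?_cons, Option.some.injEq, List.getLast?_cons_cons,
    List.isChain_cons_cons, true_and]
  grind

variable {cs} in
theorem IsBruhatPath.bruhatLE {u v : W} {Δ : List W} (h : cs.IsBruhatPath u v Δ) :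
    cs.BruhatLE u v := by
  induction Δ generalizing u with
  | nil => simp [IsBruhatPath] at h
  | cons x l ih =>
    cases l with
    | nil =>
      obtain ⟨-, rfl⟩ := cs.isBruhatPath_singleton_iff.1 h
      exact .refl
    | cons y l =>
      obtain ⟨-, h1, h2⟩ := cs.isBruhatPath_cons_cons_iff.1 h
      exact .head h1 (ih h2)

variable {cs} in
theorem BruhatLE.eq_or_length_lt {x y : W} (h : cs.BruhatLE x y) :
    x = y ∨ cs.length x < cs.length y := by
  rcases Relation.ReflTransGen.cases_head h with rfl | ⟨z, h1, h2⟩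
  · exact .inl rfl
  · exact .inr (h1.length_lt.trans_le (BruhatLE.length_le cs h2))

/-- Edges increase the length, so the bound `N` makes induction from the top well founded although W
may be infinite. -/
theorem bruhat_induction {p : W → Prop} (N : ℕ)
    (h : ∀ u, (∀ y, cs.BruhatEdge u y → cs.length y ≤ N → p y) → p u) (u : W) : p u := by
  induction hn : N + 1 - cs.length u using Nat.strong_induction_on generalizing u with
  | _ n ih =>
    refine h u fun y hy hN => ih _ ?_ y rfl
    have := hy.length_lt
    omega

variable [Finite B]

theorem mem_bruhatPaths {u v : W} {Δ : List W} :
    Δ ∈ cs.bruhatPaths u v ↔ cs.IsBruhatPath u v Δ := by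
  simp [bruhatPaths]

theorem mem_bruhatIoo {u v x : W} :
    x ∈ cs.bruhatIoo u v ↔ cs.BruhatLT u x ∧ cs.BruhatLT x v := by
  simp [bruhatIoo]

/-- The elements of length at most `N`. -/
def lengthBall (N : ℕ) : Finset W := (cs.finite_length_le N).toFinset

@[simp]
theorem mem_lengthBall {N : ℕ} {x : W} : x ∈ cs.lengthBall N ↔ cs.length x ≤ N := by
  simp [lengthBall]

/-- Paths are split after their first edge. The index set `E` is left free so that it can be a
translate of a ball or a union of copies of an interval. -/
theorem sum_bruhatPaths {R : Type*} [AddCommMonoid R] (f : List W → R) (u v : W) (E : Finset W)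
    (hE : ∀ y, cs.BruhatEdge u y → cs.BruhatLE y v → y ∈ E) :
    ∑ Δ ∈ cs.bruhatPaths u v, f Δ = (if u = v then f [u] else 0) +
      ∑ y ∈ E, if cs.BruhatEdge u y then ∑ Δ ∈ cs.bruhatPaths y v, f (u :: Δ) else 0 := by
  have key : cs.bruhatPaths u v = (if u = v then {[u]} else ∅) ∪
      (E.filter (cs.BruhatEdge u)).biUnion
        (fun y => (cs.bruhatPaths y v).map ⟨List.cons u, List.cons_injective⟩) := by
    ext Δ
    simp only [Finset.mem_union, Finset.mem_biUnion, Finset.mem_filter, Finset.mem_map,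
      Function.Embedding.coeFn_mk, mem_bruhatPaths]
    constructor
    · intro h
      obtain ⟨l, rfl⟩ := h.exists_eq_cons
      cases l with
      | nil =>
        obtain ⟨-, rfl⟩ := cs.isBruhatPath_singleton_iff.1 h
        simp
      | cons y l =>
        obtain ⟨-, h1, h2⟩ := cs.isBruhatPath_cons_cons_iff.1 h
        exact .inr ⟨y, ⟨hE y h1 h2.bruhatLE, h1⟩, _, h2, rfl⟩
    · rintro (h | ⟨y, ⟨-, h1⟩, l, h2, rfl⟩)
      · split_ifs at h with h1
        · subst h1
          rw [Finset.mem_singleton.1 h]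
          exact cs.isBruhatPath_singleton_iff.2 ⟨rfl, rfl⟩
        · simp at h
      · obtain ⟨l, rfl⟩ := h2.exists_eq_cons
        exact cs.isBruhatPath_cons_cons_iff.2 ⟨rfl, h1, h2⟩
  rw [key, Finset.sum_union, Finset.sum_biUnion]
  · congr 1
    · split_ifs <;> simp
    · rw [Finset.sum_filter]
      exact Finset.sum_congr rfl fun y _ => by simp
  · intro y _ y' _ hne
    rw [Function.onFun, Finset.disjoint_left]
    intro Δ h h'
    simp only [Finset.mem_map, Function.Embedding.coeFn_mk, mem_bruhatPaths] at h h'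
    obtain ⟨l, h, rfl⟩ := h
    obtain ⟨l', h', e⟩ := h'
    obtain ⟨l, rfl⟩ := h.exists_eq_cons
    obtain ⟨l', rfl⟩ := h'.exists_eq_cons
    simp at e
    exact hne e.1.symm
  · rw [Finset.disjoint_left]
    intro Δ h h'
    simp only [Finset.mem_biUnion, Finset.mem_map, Function.Embedding.coeFn_mk,
      mem_bruhatPaths] at h'
    obtain ⟨y, -, l, h2, rfl⟩ := h'
    obtain ⟨l, rfl⟩ := h2.exists_eq_cons
    split_ifs at h <;> simp at h

theorem bruhatPaths_eq_empty {u v : W} (h : ¬ cs.BruhatLE u v) : cs.bruhatPaths u v = ∅ := by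
  ext Δ
  simp only [mem_bruhatPaths, Finset.notMem_empty, iff_false]
  exact fun h' => h h'.bruhatLE

/-- The weight `X ^ k` of a path with `k` edges if its labels satisfy `C` and are increasing, and
`0` otherwise. -/
def ascWeight (prec : W → W → Prop) : (W → Prop) → List W → ℤ[X]
  | C, x :: y :: l =>
      if C (x⁻¹ * y) then X * ascWeight prec (fun t => C t ∧ prec (x⁻¹ * y) t) (y :: l) else 0
  | _, _ => 1

/-- The generating function, by number of edges, of the paths from `u` to `v` with increasing
labels that satisfy `C`. -/
def ascPoly (prec : W → W → Prop) (C : W → Prop) (u v : W) : ℤ[X] :=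
  ∑ Δ ∈ cs.bruhatPaths u v, ascWeight prec C Δ

theorem ascPoly_eq (prec : W → W → Prop) (C : W → Prop) (u v : W) (E : Finset W)
    (hE : ∀ y, cs.BruhatEdge u y → cs.BruhatLE y v → y ∈ E) :
    cs.ascPoly prec C u v = (if u = v then 1 else 0) +
      ∑ y ∈ E, if cs.BruhatEdge u y ∧ C (u⁻¹ * y) then
        X * cs.ascPoly prec (fun t => C t ∧ prec (u⁻¹ * y) t) y v else 0 := by
  rw [ascPoly, cs.sum_bruhatPaths _ u v E hE]
  congr 1
  refine Finset.sum_congr rfl fun y _ => ?_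
  by_cases h1 : cs.BruhatEdge u y
  · simp only [h1, if_true, true_and]
    by_cases h2 : C (u⁻¹ * y)
    · rw [if_pos h2, ascPoly, Finset.mul_sum]
      refine Finset.sum_congr rfl fun Δ hΔ => ?_
      obtain ⟨l, rfl⟩ := (cs.mem_bruhatPaths.1 hΔ).exists_eq_cons
      simp [ascWeight, h2]
    · rw [if_neg h2]
      refine Finset.sum_eq_zero fun Δ hΔ => ?_
      obtain ⟨l, rfl⟩ := (cs.mem_bruhatPaths.1 hΔ).exists_eq_cons
      simp [ascWeight, h2]
  · simp [h1]

theorem ascPoly_eq_ball (prec : W → W → Prop) (C : W → Prop) (u v : W) {N : ℕ}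
    (hN : cs.length v ≤ N) :
    cs.ascPoly prec C u v = (if u = v then 1 else 0) +
      ∑ y ∈ cs.lengthBall N, if cs.BruhatEdge u y ∧ C (u⁻¹ * y) then
        X * cs.ascPoly prec (fun t => C t ∧ prec (u⁻¹ * y) t) y v else 0 :=
  cs.ascPoly_eq prec C u v _ fun _ _ h => cs.mem_lengthBall.2 ((BruhatLE.length_le cs h).trans hN)

theorem ascPoly_eq_zero (prec : W → W → Prop) (C : W → Prop) {u v : W} (h : ¬ cs.BruhatLE u v) :
    cs.ascPoly prec C u v = 0 := by
  rw [ascPoly, cs.bruhatPaths_eq_empty h, Finset.sum_empty]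

theorem ascPoly_eq_zero_of_length_le (prec : W → W → Prop) (C : W → Prop) {u v : W} (hne : u ≠ v)
    (h : cs.length v ≤ cs.length u) : cs.ascPoly prec C u v = 0 :=
  cs.ascPoly_eq_zero prec C fun h' => by
    rcases h'.eq_or_length_lt with h' | h'
    · exact hne h'
    · omega

theorem ascPoly_self (prec : W → W → Prop) (C : W → Prop) (u : W) :
    cs.ascPoly prec C u u = 1 := by
  rw [cs.ascPoly_eq prec C u u ∅ fun y h1 h2 => absurd h1.length_lt
    (BruhatLE.length_le cs h2).not_gt]
  simp

theorem ascPoly_congr {prec prec' : W → W → Prop} {C C' : W → Prop}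
    (hC : ∀ t, cs.IsReflection t → (C t ↔ C' t))
    (hp : ∀ t t', cs.IsReflection t → cs.IsReflection t' → C t → C t' → (prec t t' ↔ prec' t t'))
    (u v : W) : cs.ascPoly prec C u v = cs.ascPoly prec' C' u v := by
  induction u using cs.bruhat_induction (cs.length v) generalizing C C' with
  | _ u ih =>
  rw [cs.ascPoly_eq_ball prec C u v le_rfl, cs.ascPoly_eq_ball prec' C' u v le_rfl]
  congr 1
  refine Finset.sum_congr rfl fun y hy => ?_
  by_cases h1 : cs.BruhatEdge u y
  · rw [← hC _ h1.isReflection]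
    by_cases h2 : C (u⁻¹ * y)
    · rw [if_pos ⟨h1, h2⟩, if_pos ⟨h1, h2⟩]
      congr 1
      refine ih y h1 (cs.mem_lengthBall.1 hy) (fun t ht => ?_) fun t t' ht ht' h h' =>
        hp t t' ht ht' h.1 h'.1
      rw [← hC t ht]
      exact and_congr_right fun h => hp _ _ h1.isReflection ht h2 h
    · simp [h2]
  · simp [h1]

/-- Right multiplication by s replaces a label t by sts, and it keeps the direction of each edge
whose label is not s. -/
theorem ascPoly_mul_simple (hM : M.IsThreeComplete) {prec prec' : W → W → Prop} {C C' : W → Prop}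
    {i : B} (hC : ∀ t, cs.IsReflection t → (C t ↔ C' (cs.simple i * t * cs.simple i)))
    (hi : ¬ C (cs.simple i))
    (hp : ∀ t t', cs.IsReflection t → cs.IsReflection t' → C t → C t' →
      (prec t t' ↔ prec' (cs.simple i * t * cs.simple i) (cs.simple i * t' * cs.simple i)))
    (u v : W) :
    cs.ascPoly prec C u v = cs.ascPoly prec' C' (u * cs.simple i) (v * cs.simple i) := by
  induction u using cs.bruhat_induction (cs.length v + 2) generalizing C C' with
  | _ u ih =>
  have hlen := cs.length_mul_simple v i
  -- A vertex y ≤ vs has ℓ(y) ≤ ℓ(v) + 1, so its translate ys has length at most ℓ(v) + 2.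
  rw [cs.ascPoly_eq_ball prec C u v (N := cs.length v + 2) (by omega),
    cs.ascPoly_eq prec' C' (u * cs.simple i) (v * cs.simple i)
    ((cs.lengthBall (cs.length v + 2)).map (mulRightEmbedding (cs.simple i))) ?_]
  · congr 1
    · simp
    rw [Finset.sum_map]
    refine Finset.sum_congr rfl fun y hy => ?_
    have e : (u * cs.simple i)⁻¹ * (y * cs.simple i) =
        cs.simple i * (u⁻¹ * y) * cs.simple i := by simp [mul_assoc]
    simp only [mulRightEmbedding_apply, e]
    have hi' : ¬ C' (cs.simple i) := by
      have := hC (cs.simple i) (cs.isReflection_simple i)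
      simp only [simple_mul_simple_self, one_mul] at this
      rwa [← this]
    have hedge : (cs.BruhatEdge u y ∧ C (u⁻¹ * y)) ↔
        (cs.BruhatEdge (u * cs.simple i) (y * cs.simple i) ∧
          C' (cs.simple i * (u⁻¹ * y) * cs.simple i)) := by
      constructor
      · rintro ⟨h1, h2⟩
        refine ⟨h1.mul_simple hM ?_, (hC _ h1.isReflection).1 h2⟩
        intro h3
        exact hi (h3 ▸ h2)
      · rintro ⟨h1, h2⟩
        have h3 := h1.mul_simple hM (i := i) (by
          rw [e]
          intro h3
          exact hi' (h3 ▸ h2))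
        simp only [simple_mul_simple_cancel_right] at h3
        exact ⟨h3, (hC _ h3.isReflection).2 h2⟩
    by_cases h1 : cs.BruhatEdge u y ∧ C (u⁻¹ * y)
    · rw [if_pos h1, if_pos (hedge.1 h1)]
      congr 1
      refine ih y h1.1 (cs.mem_lengthBall.1 hy) (fun t ht => ?_) (fun h => hi h.1)
        fun t t' ht ht' h h' => hp t t' ht ht' h.1 h'.1
      rw [← hC t ht]
      exact and_congr_right fun h => hp _ _ h1.1.isReflection ht h1.2 h
    · rw [if_neg h1, if_neg (fun h => h1 (hedge.2 h))]
  · intro y _ hy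
    simp only [Finset.mem_map, mem_lengthBall, mulRightEmbedding_apply]
    refine ⟨y * cs.simple i, ?_, by simp⟩
    have := BruhatLE.length_le cs hy
    have := cs.length_mul_simple y i
    omega

/-- An increasing path uses its labels from `C₁` before those from `C₂`; z is the vertex where it
changes over. -/
theorem ascPoly_union {prec : W → W → Prop} {C C₁ C₂ : W → Prop}
    (hC : ∀ t, cs.IsReflection t → (C t ↔ C₁ t ∨ C₂ t))
    (h12 : ∀ t₁ t₂, cs.IsReflection t₁ → cs.IsReflection t₂ → C₁ t₁ → C₂ t₂ →
      prec t₁ t₂ ∧ ¬ prec t₂ t₁) (u v : W) {N : ℕ} (hN : cs.length v ≤ N) :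
    cs.ascPoly prec C u v =
      ∑ z ∈ cs.lengthBall N, cs.ascPoly prec C₁ u z * cs.ascPoly prec C₂ z v := by
  induction u using cs.bruhat_induction N generalizing C C₁ C₂ with
  | _ u ih =>
  have hR : ∑ z ∈ cs.lengthBall N, cs.ascPoly prec C₁ u z * cs.ascPoly prec C₂ z v =
      cs.ascPoly prec C₂ u v + ∑ y ∈ cs.lengthBall N,
        if cs.BruhatEdge u y ∧ C₁ (u⁻¹ * y) then
          X * ∑ z ∈ cs.lengthBall N, cs.ascPoly prec (fun t => C₁ t ∧ prec (u⁻¹ * y) t) y z *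
            cs.ascPoly prec C₂ z v else 0 := by
    rw [Finset.sum_congr rfl fun z hz => by
      rw [cs.ascPoly_eq_ball prec C₁ u z (cs.mem_lengthBall.1 hz), add_mul, Finset.sum_mul]]
    rw [Finset.sum_add_distrib, Finset.sum_comm]
    congr 1
    · simp only [ite_mul, one_mul, zero_mul, Finset.sum_ite_eq, mem_lengthBall]
      split_ifs with h
      · rfl
      · exact (cs.ascPoly_eq_zero_of_length_le prec C₂ (by rintro rfl; omega) (by omega)).symm
    · refine Finset.sum_congr rfl fun y _ => ?_
      split_ifs
      · rw [Finset.mul_sum]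
        simp only [mul_assoc]
      · simp
  rw [hR, cs.ascPoly_eq_ball prec C u v hN, cs.ascPoly_eq_ball prec C₂ u v hN, add_assoc,
    ← Finset.sum_add_distrib]
  congr 1
  refine Finset.sum_congr rfl fun y hy => ?_
  by_cases h1 : cs.BruhatEdge u y
  swap
  · simp [h1]
  have ht := h1.isReflection
  set t := u⁻¹ * y
  by_cases h2 : C₁ t
  · have h3 : ¬ C₂ t := fun h => (h12 t t ht ht h2 h).2 (h12 t t ht ht h2 h).1
    have h4 : C t := (hC t ht).2 (.inl h2)
    rw [if_pos ⟨h1, h4⟩, if_neg (by simp [h3]), if_pos ⟨h1, h2⟩, zero_add]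
    congr 1
    refine ih y h1 (cs.mem_lengthBall.1 hy) (fun t' ht' => ?_) fun t₁ t₂ ht₁ ht₂ hC₁ hC₂ =>
      h12 t₁ t₂ ht₁ ht₂ hC₁.1 hC₂
    rw [hC t' ht', or_and_right]
    exact or_congr_right (and_iff_left_of_imp fun h => (h12 t t' ht ht' h2 h).1)
  · by_cases h3 : C₂ t
    · have h4 : C t := (hC t ht).2 (.inr h3)
      rw [if_pos ⟨h1, h4⟩, if_pos ⟨h1, h3⟩, if_neg (by simp [h2]), add_zero]
      congr 1
      refine cs.ascPoly_congr (fun t' ht' => ?_) (fun _ _ _ _ _ _ => Iff.rfl) y v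
      rw [hC t' ht', or_and_right]
      exact or_iff_right fun h => (h12 t' t ht' ht h.1 h3).2 h.2
    · have h4 : ¬ C t := fun h => ((hC t ht).1 h).elim h2 h3
      simp [h2, h3, h4]

theorem ascPoly_empty (prec : W → W → Prop) {C : W → Prop} (hC : ∀ t, ¬ C t) (u v : W) :
    cs.ascPoly prec C u v = if u = v then 1 else 0 := by
  rw [cs.ascPoly_eq_ball prec C u v le_rfl]
  simp [hC]

theorem ascPoly_singleton {prec : W → W → Prop} {t : W} (ht : ¬ prec t t) (u v : W) :
    cs.ascPoly prec (· = t) u v = (if u = v then 1 else 0) +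
      if v = u * t ∧ cs.BruhatEdge u v then X else 0 := by
  rw [cs.ascPoly_eq_ball prec _ u v le_rfl]
  congr 1
  have : ∀ y ∈ cs.lengthBall (cs.length v), (if cs.BruhatEdge u y ∧ u⁻¹ * y = t then
      X * cs.ascPoly prec (fun t' => t' = t ∧ prec (u⁻¹ * y) t') y v else 0) =
      if y = v then (if v = u * t ∧ cs.BruhatEdge u v then X else 0) else 0 := by
    intro y _
    by_cases h : cs.BruhatEdge u y ∧ u⁻¹ * y = t
    · rw [if_pos h, cs.ascPoly_empty]
      · by_cases hy : y = v
        · subst hy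
          simp [h.1, ← h.2]
        · simp [hy]
      · rintro t' ⟨rfl, h'⟩
        exact ht (h.2 ▸ h')
    · rw [if_neg h]
      by_cases hy : y = v
      · subst hy
        rw [if_pos rfl, if_neg]
        rintro ⟨h1, h2⟩
        exact h ⟨h2, by simp [h1]⟩
      · simp [hy]
  rw [Finset.sum_congr rfl this]
  simp

end CoxeterSystem
end

/-! ### Independence of the increasing-path polynomials from the reflection ordering -/

noncomputable section

namespace CoxeterSystem

open Classical Polynomial CoxeterMatrix

variable {B W : Type*} [Group W] {M : CoxeterMatrix B} {cs : CoxeterSystem M W}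

/-- The order obtained from `prec` by conjugating by `s` the part above `s`, and moving `s` to the
top. -/
def upperConj (prec : W → W → Prop) (s : W) (t t' : W) : Prop :=
  t ≠ s ∧ (t' = s ∨ (prec t s ∧ prec t' s ∧ prec t t') ∨ (prec t s ∧ prec s t') ∨
    (prec s t ∧ prec s t' ∧ prec (s * t * s) (s * t' * s)))

/-- The order obtained from an order `prec` with greatest element `s` by conjugating by `s`, and
moving `s` to the bottom. -/
def firstConj (prec : W → W → Prop) (s : W) (t t' : W) : Prop :=
  t' ≠ s ∧ (t = s ∨ prec (s * t * s) (s * t' * s))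

namespace IsReflectionOrdering

variable {prec : W → W → Prop} (h : cs.IsReflectionOrdering prec)
include h

theorem asymm {t t' : W} (ht : cs.IsReflection t) (ht' : cs.IsReflection t') (h1 : prec t t') :
    ¬ prec t' t :=
  fun h2 => h.irrefl t ht (h.trans _ _ _ ht ht' ht h1 h2)

theorem between' {t₁ t₂ t : W} {β₁ β₂ β : B →₀ ℝ} {c₁ c₂ : ℝ} (h₁ : cs.IsPositiveRootOf t₁ β₁)
    (h₂ : cs.IsPositiveRootOf t₂ β₂) (ht : cs.IsPositiveRootOf t β) (hc₁ : 0 < c₁) (hc₂ : 0 < c₂)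
    (e : β = c₁ • β₁ + c₂ • β₂) (hp : prec t₂ t₁) : prec t₂ t ∧ prec t t₁ :=
  h.between t₂ t₁ t β₂ β₁ β c₂ c₁ h₂ h₁ ht hc₂ hc₁ (by rw [e, add_comm]) hp

/-- One of β and sβ is a positive combination of the other and α_s unless they coincide, so the
reflections t and sts lie on the same side of s. -/
theorem prec_simple_conj (hM : M.IsThreeComplete) {t : W} (ht : cs.IsReflection t) {i : B} :
    (prec (cs.simple i) t → prec (cs.simple i) (cs.simple i * t * cs.simple i)) ∧
    (prec t (cs.simple i) → prec (cs.simple i * t * cs.simple i) (cs.simple i)) := by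
  by_cases hne : t = cs.simple i
  · subst hne
    simp
  obtain ⟨β, hβ⟩ := ht.exists_isPositiveRootOf hM
  have hi := cs.isPositiveRootOf_simple i
  have hβ' := hβ.simple_conj hM hne
  have ht' := simple_conj_isReflection ht i
  have e := cs.geometricRep_simple_apply i β
  rcases lt_trichotomy (M.simpleCoroot i β) 0 with h0 | h0 | h0
  · have e' : cs.geometricRep (cs.simple i) β =
        (-M.simpleCoroot i β) • simpleRoot i + (1 : ℝ) • β := by rw [e]; module
    exact ⟨fun hp => (h.between _ _ _ _ _ _ _ _ hi hβ hβ' (by linarith) one_pos e' hp).1,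
      fun hp => (h.between' hi hβ hβ' (by linarith) one_pos e' hp).2⟩
  · rw [h0, zero_smul, sub_zero] at e
    rw [e] at hβ'
    rw [← hβ.reflection_unique hM hβ']
    exact ⟨id, id⟩
  · have e' : β = (M.simpleCoroot i β) • simpleRoot i +
        (1 : ℝ) • cs.geometricRep (cs.simple i) β := by rw [e]; module
    constructor <;> intro hp
    · refine (h.total _ _ (cs.isReflection_simple i) ht' ?_).resolve_right fun hp' => ?_
      · intro h1
        apply hne
        simpa [mul_assoc, mul_inv_eq_iff_eq_mul] using
          congrArg (fun x => cs.simple i * x * cs.simple i) h1.symm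
      · exact h.asymm (cs.isReflection_simple i) ht hp
          (h.between' hi hβ' hβ h0 one_pos e' hp').2
    · refine (h.total _ _ ht' (cs.isReflection_simple i) ?_).resolve_right fun hp' => ?_
      · intro h1
        apply hne
        simpa [mul_assoc, mul_inv_eq_iff_eq_mul] using
          congrArg (fun x => cs.simple i * x * cs.simple i) h1
      · exact h.asymm ht (cs.isReflection_simple i) hp
          (h.between _ _ _ _ _ _ _ _ hi hβ' hβ h0 one_pos e' hp').1

end IsReflectionOrdering

theorem simple_conj_conj (i : B) (t : W) :
    cs.simple i * (cs.simple i * t * cs.simple i) * cs.simple i = t := by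
  simp [mul_assoc]

theorem simple_conj_injective (i : B) :
    Function.Injective fun t => cs.simple i * t * cs.simple i := fun t t' e => by
  simpa [mul_assoc] using congrArg (fun x => cs.simple i * x * cs.simple i) e

theorem simple_conj_eq_simple_iff {i : B} {t : W} :
    cs.simple i * t * cs.simple i = cs.simple i ↔ t = cs.simple i := by
  constructor
  · intro e
    exact simple_conj_injective i (e.trans (by simp))
  · rintro rfl
    simp

/-- A simple root spans an extreme ray of the cone of nonnegative vectors. -/
theorem IsPositiveRootOf.ne_simple (hM : M.IsThreeComplete) {t₁ t₂ t : W} {β₁ β₂ β : B →₀ ℝ}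
    {c₁ c₂ : ℝ} (h₁ : cs.IsPositiveRootOf t₁ β₁)
    (h₂ : cs.IsPositiveRootOf t₂ β₂) (ht : cs.IsPositiveRootOf t β) (hc₁ : 0 < c₁) (hc₂ : 0 < c₂)
    (e : β = c₁ • β₁ + c₂ • β₂) (hne : t₁ ≠ t₂) (i : B) : t ≠ cs.simple i := by
  rintro rfl
  have hβ := ht.unique (cs.isPositiveRootOf_simple i)
  have key : ∀ j, j ≠ i → β₁ j = 0 ∧ β₂ j = 0 := by
    intro j hj
    have h0 : β j = 0 := by rw [hβ]; simp [simpleRoot, hj.symm]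
    rw [e, Finsupp.add_apply, Finsupp.smul_apply, Finsupp.smul_apply, smul_eq_mul,
      smul_eq_mul] at h0
    have h3 : 0 ≤ β₁ j := h₁.nonneg j
    have h4 : 0 ≤ β₂ j := h₂.nonneg j
    have h5 := mul_nonneg hc₁.le h3
    have h6 := mul_nonneg hc₂.le h4
    exact ⟨(mul_eq_zero.1 (by linarith : c₁ * β₁ j = 0)).resolve_left hc₁.ne',
      (mul_eq_zero.1 (by linarith : c₂ * β₂ j = 0)).resolve_left hc₂.ne'⟩
  exact hne ((h₁.eq_simple hM fun j hj => (key j hj).1).trans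
    (h₂.eq_simple hM fun j hj => (key j hj).2).symm)

theorem geometricRep_comb (w : W) {β₁ β₂ β : B →₀ ℝ} {c₁ c₂ : ℝ} (e : β = c₁ • β₁ + c₂ • β₂) :
    cs.geometricRep w β = c₁ • cs.geometricRep w β₁ + c₂ • cs.geometricRep w β₂ := by
  rw [e, map_add, map_smul, map_smul]

/-- Reflection in α_i reverses betweenness relative to α_i: if β lies between β₁ and α_i, then s_i
β₁ lies between s_i β and α_i. -/
theorem geometricRep_comb_simple {i : B} {β₁ β : B →₀ ℝ} {c₁ c₂ : ℝ} (hc : 0 < c₁)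
    (e : β = c₁ • β₁ + c₂ • simpleRoot i) :
    cs.geometricRep (cs.simple i) β₁ =
      c₁⁻¹ • cs.geometricRep (cs.simple i) β + (c₁⁻¹ * c₂) • simpleRoot i := by
  rw [geometricRep_comb _ e, geometricRep_simple_self, smul_add, smul_smul, inv_mul_cancel₀ hc.ne']
  module

/-- The set of reflections above s is stable under conjugation by s, so conjugating only this block
keeps betweenness inside it. It remains to compare the blocks with each other and with s. -/
theorem IsReflectionOrdering.upperConj (hM : M.IsThreeComplete) {prec : W → W → Prop}
    (h : cs.IsReflectionOrdering prec) (i : B) :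
    cs.IsReflectionOrdering (upperConj prec (cs.simple i)) := by
  have hi := cs.isReflection_simple i
  have hri := cs.isPositiveRootOf_simple i
  have hcr : ∀ {t}, cs.IsReflection t → cs.IsReflection (cs.simple i * t * cs.simple i) :=
    fun ht => simple_conj_isReflection ht i
  refine ⟨?_, ?_, ?_, ?_⟩
  · rintro t ht ⟨h1, h2 | h2 | h2 | h2⟩
    · exact h1 h2
    · exact h.irrefl _ ht h2.2.2
    · exact h.asymm ht hi h2.1 h2.2
    · exact h.irrefl _ (hcr ht) h2.2.2
  · rintro t₁ t₂ t₃ ht₁ ht₂ ht₃ ⟨h1, h2⟩ ⟨h3, h4⟩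
    refine ⟨h1, ?_⟩
    have hA := h.trans _ _ _ ht₁ ht₂ ht₃
    have hC := h.trans _ _ _ (hcr ht₁) (hcr ht₂) (hcr ht₃)
    have := h.asymm ht₂ hi
    tauto
  · intro t₁ t₂ ht₁ ht₂ hne
    by_cases h1 : t₁ = cs.simple i
    · exact .inr ⟨by rintro rfl; exact hne h1, .inl h1⟩
    by_cases h2 : t₂ = cs.simple i
    · exact .inl ⟨h1, .inl h2⟩
    have a1 := h.total _ _ ht₁ hi h1
    have a2 := h.total _ _ ht₂ hi h2
    have a3 := h.total _ _ ht₁ ht₂ hne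
    have a4 := h.total _ _ (hcr ht₁) (hcr ht₂) fun e => hne (simple_conj_injective i e)
    rcases a1 with a1 | a1 <;> rcases a2 with a2 | a2
    · exact a3.imp (fun a => ⟨h1, .inr (.inl ⟨a1, a2, a⟩)⟩) fun a => ⟨h2, .inr (.inl ⟨a2, a1, a⟩)⟩
    · exact .inl ⟨h1, .inr (.inr (.inl ⟨a1, a2⟩))⟩
    · exact .inr ⟨h2, .inr (.inr (.inl ⟨a2, a1⟩))⟩
    · exact a4.imp (fun a => ⟨h1, .inr (.inr (.inr ⟨a1, a2, a⟩))⟩)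
        fun a => ⟨h2, .inr (.inr (.inr ⟨a2, a1, a⟩))⟩
  · rintro t₁ t₂ t β₁ β₂ β c₁ c₂ h₁ h₂ ht hc₁ hc₂ e ⟨hn, hp⟩
    have ht₁ := h₁.isReflection
    have ht₂ := h₂.isReflection
    have htr := ht.isReflection
    have hn' : t ≠ cs.simple i := h₁.ne_simple hM h₂ ht hc₁ hc₂ e (by
      rintro rfl
      rcases hp with hp | hp | hp | hp
      · exact hn hp
      · exact h.irrefl _ ht₁ hp.2.2
      · exact h.asymm ht₁ hi hp.1 hp.2
      · exact h.irrefl _ (hcr ht₁) hp.2.2) i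
    have ht' := ht.simple_conj hM hn'
    have h₁' := h₁.simple_conj hM hn
    unfold CoxeterSystem.upperConj
    rcases hp with rfl | ⟨hp1, hp2, hp3⟩ | ⟨hp1, hp2⟩ | ⟨hp1, hp2, hp3⟩
    · obtain rfl := h₂.unique hri
      rcases h.total _ _ ht₁ hi hn with h1 | h1
      · have := h.between _ _ _ _ _ _ _ _ h₁ h₂ ht hc₁ hc₂ e h1
        tauto
      -- Here t₁ and t are above s; after conjugation s t₁ s lies between s and sts, which gives the
      -- new order t₁, t, s.
      · have h3 := h.between' h₁ h₂ ht hc₁ hc₂ e h1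
        have h4 := h.between' ht' h₂ h₁' (inv_pos.2 hc₁) (mul_pos (inv_pos.2 hc₁) hc₂)
          (geometricRep_comb_simple hc₁ e) ((h.prec_simple_conj hM htr).1 h3.1)
        tauto
    · have h3 := h.between _ _ _ _ _ _ _ _ h₁ h₂ ht hc₁ hc₂ e hp3
      have h4 := h.trans _ _ _ htr ht₂ hi h3.2 hp2
      tauto
    · have h3 := h.between _ _ _ _ _ _ _ _ h₁ h₂ ht hc₁ hc₂ e (h.trans _ _ _ ht₁ hi ht₂ hp1 hp2)
      rcases h.total _ _ htr hi hn' with h5 | h5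
      · tauto
      -- Now t lies above s. The conjugate of t₁ stays below s and that of t₂ above s, so
      -- betweenness places sts before s t₂ s.
      · have h₂' := h₂.simple_conj hM (i := i) (by rintro rfl; exact h.irrefl _ hi hp2)
        have h6 := h.between _ _ _ _ _ _ _ _ h₁' h₂' ht' hc₁ hc₂ (geometricRep_comb _ e)
          (h.trans _ _ _ (hcr ht₁) hi (hcr ht₂) ((h.prec_simple_conj hM ht₁).2 hp1)
            ((h.prec_simple_conj hM ht₂).1 hp2))
        tauto
    · have h₂' := h₂.simple_conj hM (i := i) (by rintro rfl; exact h.irrefl _ hi hp2)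
      have h6 := h.between _ _ _ _ _ _ _ _ h₁' h₂' ht' hc₁ hc₂ (geometricRep_comb _ e) hp3
      have h7 := (h.prec_simple_conj hM (hcr htr)).1
        (h.trans _ _ _ hi (hcr ht₁) (hcr htr) ((h.prec_simple_conj hM ht₁).1 hp1) h6.1)
      rw [simple_conj_conj] at h7
      tauto

/-- Combinations not involving α_s are carried over by conjugation. For those involving α_s, the
reflection reverses betweenness relative to α_s, which matches moving s from the last to the first
place. -/
theorem IsReflectionOrdering.firstConj (hM : M.IsThreeComplete) {prec : W → W → Prop}
    (h : cs.IsReflectionOrdering prec) (i : B)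
    (hlast : ∀ t, cs.IsReflection t → t ≠ cs.simple i → prec t (cs.simple i)) :
    cs.IsReflectionOrdering (firstConj prec (cs.simple i)) := by
  have hi := cs.isReflection_simple i
  have hri := cs.isPositiveRootOf_simple i
  have hcr : ∀ {t}, cs.IsReflection t → cs.IsReflection (cs.simple i * t * cs.simple i) :=
    fun ht => simple_conj_isReflection ht i
  refine ⟨?_, ?_, ?_, ?_⟩
  · rintro t ht ⟨h1, h2 | h2⟩
    · exact h1 h2
    · exact h.irrefl _ (hcr ht) h2
  · rintro t₁ t₂ t₃ ht₁ ht₂ ht₃ ⟨h1, h2⟩ ⟨h3, h4⟩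
    have hC := h.trans _ _ _ (hcr ht₁) (hcr ht₂) (hcr ht₃)
    exact ⟨h3, by tauto⟩
  · intro t₁ t₂ ht₁ ht₂ hne
    have a4 := h.total _ _ (hcr ht₁) (hcr ht₂) fun e => hne (simple_conj_injective i e)
    by_cases h1 : t₁ = cs.simple i
    · exact .inl ⟨by rintro rfl; exact hne h1, .inl h1⟩
    by_cases h2 : t₂ = cs.simple i
    · exact .inr ⟨h1, .inl h2⟩
    unfold CoxeterSystem.firstConj
    tauto
  · rintro t₁ t₂ t β₁ β₂ β c₁ c₂ h₁ h₂ ht hc₁ hc₂ e ⟨hn, hp⟩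
    have ht₁ := h₁.isReflection
    have hn' : t ≠ cs.simple i := h₁.ne_simple hM h₂ ht hc₁ hc₂ e (by
      rintro rfl
      rcases hp with hp | hp
      · exact hn hp
      · exact h.irrefl _ (hcr ht₁) hp) i
    have ht' := ht.simple_conj hM hn'
    have h₂' := h₂.simple_conj hM hn
    have hl := hlast _ ht'.isReflection fun h3 => hn' (simple_conj_eq_simple_iff.1 h3)
    unfold CoxeterSystem.firstConj
    by_cases h1 : t₁ = cs.simple i
    · subst h1
      obtain rfl := h₁.unique hri
      have h4 := h.between _ _ _ _ _ _ _ _ ht' h₁ h₂' (inv_pos.2 hc₂)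
        (mul_pos (inv_pos.2 hc₂) hc₁)
        (geometricRep_comb_simple hc₂ (by rw [e, add_comm])) hl
      tauto
    · have h4 := h.between _ _ _ _ _ _ _ _ (h₁.simple_conj hM h1) h₂' ht' hc₁ hc₂
        (geometricRep_comb _ e) (hp.resolve_left h1)
      tauto

theorem bruhatEdge_mul_simple_iff {w : W} {i : B} :
    cs.BruhatEdge w (w * cs.simple i) ↔ cs.length w < cs.length (w * cs.simple i) := by
  rw [bruhatEdge_iff, inv_mul_cancel_left]
  exact and_iff_right (cs.isReflection_simple i)

variable [Finite B]

/-- When s precedes all other admissible labels, an increasing path can use it only on its first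
edge. -/
theorem ascPoly_of_simple_first {prec : W → W → Prop} {C D : W → Prop} {i : B}
    (hD : ∀ t, cs.IsReflection t → (D t ↔ t = cs.simple i ∨ C t))
    (hC : ∀ t, cs.IsReflection t → C t → prec (cs.simple i) t ∧ ¬ prec t (cs.simple i))
    (hi : ¬ prec (cs.simple i) (cs.simple i)) (u v : W) :
    cs.ascPoly prec D u v = cs.ascPoly prec C u v +
      if cs.length u < cs.length (u * cs.simple i) then
        X * cs.ascPoly prec C (u * cs.simple i) v else 0 := by
  rw [cs.ascPoly_union (C₁ := (· = cs.simple i)) (C₂ := C) hD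
    (by rintro t₁ t₂ - ht₂ rfl h2; exact hC t₂ ht₂ h2) u v
    (N := cs.length v + cs.length u + 1) (by omega)]
  simp only [cs.ascPoly_singleton hi, add_mul, Finset.sum_add_distrib, ite_and, ite_mul, one_mul,
    zero_mul]
  rw [Finset.sum_ite_eq, Finset.sum_ite_eq', if_pos (by simp; omega), if_pos]
  · simp only [bruhatEdge_mul_simple_iff]
  · have := cs.length_mul_simple u i
    simp; omega

theorem ascPoly_of_simple_last {prec : W → W → Prop} {C D : W → Prop} {i : B}
    (hD : ∀ t, cs.IsReflection t → (D t ↔ t = cs.simple i ∨ C t))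
    (hC : ∀ t, cs.IsReflection t → C t → prec t (cs.simple i) ∧ ¬ prec (cs.simple i) t)
    (hi : ¬ prec (cs.simple i) (cs.simple i)) (u v : W) :
    cs.ascPoly prec D u v = cs.ascPoly prec C u v +
      if cs.length (v * cs.simple i) < cs.length v then
        X * cs.ascPoly prec C u (v * cs.simple i) else 0 := by
  rw [cs.ascPoly_union (C₁ := C) (C₂ := (· = cs.simple i)) (fun t ht => (hD t ht).trans or_comm)
    (by rintro t₁ t₂ ht₁ - h1 rfl; exact hC t₁ ht₁ h1) u v
    (N := cs.length v + 1) (by omega)]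
  have e : ∀ z, v = z * cs.simple i ↔ z = v * cs.simple i := fun z => by
    constructor <;> rintro rfl <;> simp
  simp only [cs.ascPoly_singleton hi, mul_add, Finset.sum_add_distrib, ite_and, mul_ite, mul_one,
    mul_zero, e]
  rw [Finset.sum_ite_eq', Finset.sum_ite_eq', if_pos (by simp), if_pos]
  · have := bruhatEdge_mul_simple_iff (cs := cs) (w := v * cs.simple i) (i := i)
    rw [simple_mul_simple_cancel_right] at this
    simp only [this, mul_comm]
  · have := cs.length_mul_simple v i
    simp; omega

namespace IsReflectionOrdering

variable {prec : W → W → Prop} (h : cs.IsReflectionOrdering prec)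
include h

theorem ascPoly_eq_sum (i : B) (u v : W) :
    cs.ascPoly prec (fun _ => True) u v = ∑ z ∈ cs.lengthBall (cs.length v),
      cs.ascPoly prec (fun t => prec t (cs.simple i)) u z *
        cs.ascPoly prec (fun t => t = cs.simple i ∨ prec (cs.simple i) t) z v := by
  have hi := cs.isReflection_simple i
  refine cs.ascPoly_union (fun t ht => ?_) (fun t₁ t₂ ht₁ ht₂ h1 h2 => ?_) u v le_rfl
  · have := h.total _ _ ht hi
    tauto
  · have : prec t₁ t₂ := by
      rcases h2 with rfl | h2
      · exact h1
      · exact h.trans _ _ _ ht₁ hi ht₂ h1 h2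
    exact ⟨this, h.asymm ht₁ ht₂ this⟩

/-- Both orderings agree below s, so the first factor is that of `prec` and only the factor for s
and the labels above it has to be compared. -/
theorem ascPoly_upperConj_eq_sum (i : B) (u v : W) :
    cs.ascPoly (CoxeterSystem.upperConj prec (cs.simple i)) (fun _ => True) u v =
      ∑ z ∈ cs.lengthBall (cs.length v),
      cs.ascPoly prec (fun t => prec t (cs.simple i)) u z *
        cs.ascPoly (CoxeterSystem.upperConj prec (cs.simple i))
          (fun t => t = cs.simple i ∨ prec (cs.simple i) t) z v := by
  have hi := cs.isReflection_simple i
  rw [cs.ascPoly_union (C₁ := fun t => prec t (cs.simple i))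
    (C₂ := fun t => t = cs.simple i ∨ prec (cs.simple i) t) (fun t ht => ?_)
    (fun t₁ t₂ ht₁ ht₂ h1 h2 => ?_) u v le_rfl]
  · refine Finset.sum_congr rfl fun z _ => ?_
    congr 1
    refine cs.ascPoly_congr (fun t ht => Iff.rfl) (fun t t' ht ht' h1 h2 => ?_) u z
    have a1 : t ≠ cs.simple i := by rintro rfl; exact h.irrefl _ hi h1
    have a2 : t' ≠ cs.simple i := by rintro rfl; exact h.irrefl _ hi h2
    have a3 := h.asymm ht hi h1
    have a4 := h.asymm ht' hi h2
    unfold CoxeterSystem.upperConj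
    tauto
  · have := h.total _ _ ht hi
    tauto
  · have a1 : t₁ ≠ cs.simple i := by rintro rfl; exact h.irrefl _ hi h1
    have a2 := h.asymm ht₁ hi h1
    have a3 := h.asymm ht₂ hi
    unfold CoxeterSystem.upperConj
    tauto

theorem ascPoly_above_mul_simple (hM : M.IsThreeComplete) (i : B) (u v : W) :
    cs.ascPoly (CoxeterSystem.upperConj prec (cs.simple i)) (prec (cs.simple i)) u v =
      cs.ascPoly prec (prec (cs.simple i)) (u * cs.simple i) (v * cs.simple i) := by
  have hi := cs.isReflection_simple i
  refine cs.ascPoly_mul_simple hM (fun t ht => ?_) (h.irrefl _ hi) (fun t t' ht ht' h1 h2 => ?_) u v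
  · refine ⟨(h.prec_simple_conj hM ht).1, fun h1 => ?_⟩
    have := (h.prec_simple_conj hM (simple_conj_isReflection ht i)).1 h1
    rwa [simple_conj_conj] at this
  · have a1 : t ≠ cs.simple i := by rintro rfl; exact h.irrefl _ hi h1
    have a2 : t' ≠ cs.simple i := by rintro rfl; exact h.irrefl _ hi h2
    have a3 := h.asymm hi ht h1
    have a4 := h.asymm hi ht' h2
    unfold CoxeterSystem.upperConj
    tauto

theorem ascPoly_simple_above (i : B) (u v : W) :
    cs.ascPoly prec (fun t => t = cs.simple i ∨ prec (cs.simple i) t) u v =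
      cs.ascPoly prec (prec (cs.simple i)) u v +
      if cs.length u < cs.length (u * cs.simple i) then
        X * cs.ascPoly prec (prec (cs.simple i)) (u * cs.simple i) v else 0 :=
  ascPoly_of_simple_first (fun _ _ => Iff.rfl)
    (fun _ ht h1 => ⟨h1, h.asymm (cs.isReflection_simple i) ht h1⟩)
    (h.irrefl _ (cs.isReflection_simple i)) u v

theorem ascPoly_upperConj_simple_above (hM : M.IsThreeComplete) (i : B) (u v : W) :
    cs.ascPoly (CoxeterSystem.upperConj prec (cs.simple i))
        (fun t => t = cs.simple i ∨ prec (cs.simple i) t) u v =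
      cs.ascPoly prec (prec (cs.simple i)) (u * cs.simple i) (v * cs.simple i) +
      if cs.length (v * cs.simple i) < cs.length v then
        X * cs.ascPoly prec (prec (cs.simple i)) (u * cs.simple i) v else 0 := by
  rw [ascPoly_of_simple_last (C := prec (cs.simple i)) (fun _ _ => Iff.rfl),
    h.ascPoly_above_mul_simple hM, h.ascPoly_above_mul_simple hM, simple_mul_simple_cancel_right]
  · intro t ht h1
    have a1 : t ≠ cs.simple i := by rintro rfl; exact h.irrefl _ ht h1
    unfold CoxeterSystem.upperConj
    tauto
  · unfold CoxeterSystem.upperConj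
    tauto

/-- The common first factor is unitriangular with respect to length: it is 1 at z = u and 0 at every
other z not longer than u. Hence it can be cancelled. -/
theorem ascPoly_simple_above_eq_of_eq {i : B} {v : W}
    (hv : ∀ u, cs.ascPoly prec (fun _ => True) u v =
      cs.ascPoly (CoxeterSystem.upperConj prec (cs.simple i)) (fun _ => True) u v) (u : W) :
    cs.ascPoly prec (fun t => t = cs.simple i ∨ prec (cs.simple i) t) u v =
      cs.ascPoly (CoxeterSystem.upperConj prec (cs.simple i))
        (fun t => t = cs.simple i ∨ prec (cs.simple i) t) u v := by
  induction hn : cs.length v + 1 - cs.length u using Nat.strong_induction_on generalizing u with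
  | _ n ih =>
  by_cases hu : cs.length u ≤ cs.length v
  swap
  · have hne : u ≠ v := by rintro rfl; exact hu le_rfl
    rw [cs.ascPoly_eq_zero_of_length_le _ _ hne (by omega),
      cs.ascPoly_eq_zero_of_length_le _ _ hne (by omega)]
  have key := hv u
  rw [h.ascPoly_eq_sum i, h.ascPoly_upperConj_eq_sum i,
    ← Finset.add_sum_erase _ _ (cs.mem_lengthBall.2 hu),
    ← Finset.add_sum_erase _ _ (cs.mem_lengthBall.2 hu), ascPoly_self, one_mul, one_mul] at key
  refine add_right_cancel (key.trans ?_)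
  congr 1
  refine Finset.sum_congr rfl fun z hz => ?_
  obtain ⟨hz1, hz2⟩ := Finset.mem_erase.1 hz
  rw [mem_lengthBall] at hz2
  rcases le_or_gt (cs.length z) (cs.length u) with h1 | h1
  · rw [cs.ascPoly_eq_zero_of_length_le _ _ hz1.symm h1, zero_mul, zero_mul]
  · rw [ih _ (by omega) z rfl]

/-- Expressed through the paths with labels above s, the claim at (u, v) is a consequence of the
hypothesis at (u, vs) and (us, vs). Which instance loses its X-term depends on which of u and us is
shorter. -/
theorem ascPoly_simple_above_eq (hM : M.IsThreeComplete) {i : B} {v : W}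
    (hlt : cs.length (v * cs.simple i) < cs.length v)
    (hv : ∀ u, cs.ascPoly prec (fun t => t = cs.simple i ∨ prec (cs.simple i) t) u
        (v * cs.simple i) =
      cs.ascPoly (CoxeterSystem.upperConj prec (cs.simple i))
        (fun t => t = cs.simple i ∨ prec (cs.simple i) t) u (v * cs.simple i)) (u : W) :
    cs.ascPoly prec (fun t => t = cs.simple i ∨ prec (cs.simple i) t) u v =
      cs.ascPoly (CoxeterSystem.upperConj prec (cs.simple i))
        (fun t => t = cs.simple i ∨ prec (cs.simple i) t) u v := by
  simp only [h.ascPoly_simple_above, h.ascPoly_upperConj_simple_above hM,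
    simple_mul_simple_cancel_right, if_neg hlt.not_gt, if_pos hlt, add_zero] at hv ⊢
  have h1 := hv u
  have h2 := hv (u * cs.simple i)
  rw [simple_mul_simple_cancel_right] at h2
  rcases (cs.length_mul_simple_ne u i).lt_or_gt with h3 | h3
  · rw [if_neg h3.not_gt, add_zero] at h1 ⊢
    rw [if_pos h3, h1] at h2
    exact h2.symm
  · rw [if_neg h3.not_gt, add_zero] at h2
    rw [if_pos h3, h2]

theorem ascPoly_eq_upperConj (hM : M.IsThreeComplete) {i : B} {v : W}
    (hlt : cs.length (v * cs.simple i) < cs.length v)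
    (hv : ∀ u, cs.ascPoly prec (fun _ => True) u (v * cs.simple i) =
      cs.ascPoly (CoxeterSystem.upperConj prec (cs.simple i)) (fun _ => True) u
        (v * cs.simple i)) (u : W) :
    cs.ascPoly prec (fun _ => True) u v =
      cs.ascPoly (CoxeterSystem.upperConj prec (cs.simple i)) (fun _ => True) u v := by
  rw [h.ascPoly_eq_sum i, h.ascPoly_upperConj_eq_sum i]
  refine Finset.sum_congr rfl fun z _ => ?_
  rw [h.ascPoly_simple_above_eq hM hlt (h.ascPoly_simple_above_eq_of_eq hv)]

/-- The recursion of the R̃-polynomials at a right descent: a last edge labelled s is split off, and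
the paths that avoid the label s are translated by s. In the translated ordering s comes first,
which produces the correction term. -/
theorem ascPoly_eq_of_simple_last (hM : M.IsThreeComplete) {i : B}
    (hlast : ∀ t, cs.IsReflection t → t ≠ cs.simple i → prec t (cs.simple i)) {v : W}
    (hlt : cs.length (v * cs.simple i) < cs.length v) (u : W) :
    cs.ascPoly prec (fun _ => True) u v =
      cs.ascPoly (CoxeterSystem.firstConj prec (cs.simple i)) (fun _ => True)
        (u * cs.simple i) (v * cs.simple i) -
      (if cs.length (u * cs.simple i) < cs.length u then
        X * cs.ascPoly (CoxeterSystem.firstConj prec (cs.simple i)) (fun _ => True) u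
          (v * cs.simple i) else 0) +
      X * cs.ascPoly prec (fun _ => True) u (v * cs.simple i) := by
  have hi := cs.isReflection_simple i
  have h1 := ascPoly_of_simple_last (cs := cs) (prec := prec) (C := (· ≠ cs.simple i))
    (D := fun _ => True) (i := i) (fun t _ => by tauto)
    (fun t ht h1 => ⟨hlast t ht h1, h.asymm ht hi (hlast t ht h1)⟩) (h.irrefl _ hi)
  have h2 := ascPoly_of_simple_first (cs := cs)
    (prec := CoxeterSystem.firstConj prec (cs.simple i)) (C := (· ≠ cs.simple i))
    (D := fun _ => True) (i := i) (fun t _ => by tauto)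
    (fun t ht h1 => by unfold CoxeterSystem.firstConj; tauto)
    (by unfold CoxeterSystem.firstConj; tauto)
  have h3 := cs.ascPoly_mul_simple hM (prec := prec)
    (prec' := CoxeterSystem.firstConj prec (cs.simple i)) (C := (· ≠ cs.simple i))
    (C' := (· ≠ cs.simple i)) (i := i)
    (fun t ht => not_congr simple_conj_eq_simple_iff.symm) (by simp)
    (fun t t' ht ht' h1 h2 => by
      have a1 := mt (simple_conj_eq_simple_iff (cs := cs) (i := i)).1 h1
      have a2 := mt (simple_conj_eq_simple_iff (cs := cs) (i := i)).1 h2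
      unfold CoxeterSystem.firstConj
      rw [simple_conj_conj, simple_conj_conj]
      tauto)
  simp only [h1, h2, simple_mul_simple_cancel_right, if_neg hlt.not_gt, if_pos hlt, h3 u v, add_zero]
  rcases (cs.length_mul_simple_ne u i).lt_or_gt with h4 | h4
  · rw [if_pos h4, if_pos h4, if_neg h4.not_gt]
    ring
  · rw [if_neg h4.not_gt, if_neg h4.not_gt]
    ring

end IsReflectionOrdering

/-- For a right descent s of v, passing to `upperConj` makes s last and preserves the polynomial.
The recursion then only involves polynomials ending at vs, which are independent of the ordering by
induction. -/
theorem ascPoly_independent (hM : M.IsThreeComplete) {prec prec' : W → W → Prop}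
    (h : cs.IsReflectionOrdering prec) (h' : cs.IsReflectionOrdering prec') (u v : W) :
    cs.ascPoly prec (fun _ => True) u v = cs.ascPoly prec' (fun _ => True) u v := by
  induction hn : cs.length v using Nat.strong_induction_on generalizing u v prec prec' with
  | _ n ih =>
  by_cases hv : v = 1
  · subst hv
    by_cases hu : u = 1
    · subst hu
      rw [ascPoly_self, ascPoly_self]
    · rw [cs.ascPoly_eq_zero_of_length_le _ _ hu (by simp),
        cs.ascPoly_eq_zero_of_length_le _ _ hu (by simp)]
  obtain ⟨i, hi⟩ := cs.exists_rightDescent_of_ne_one hv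
  have hlast : ∀ (p : W → W → Prop) (t : W), cs.IsReflection t → t ≠ cs.simple i →
      upperConj p (cs.simple i) t (cs.simple i) := fun p t _ h1 => ⟨h1, .inl rfl⟩
  have key : ∀ {p : W → W → Prop} (hp : cs.IsReflectionOrdering p) (x y : W),
      cs.length y < n → cs.ascPoly p (fun _ => True) x y = cs.ascPoly prec (fun _ => True) x y :=
    fun hp x y hy => ih _ hy hp h x y rfl
  rw [IsRightDescent] at hi
  have step : ∀ {p : W → W → Prop} (hp : cs.IsReflectionOrdering p),
      cs.ascPoly p (fun _ => True) u v =
        cs.ascPoly prec (fun _ => True) (u * cs.simple i) (v * cs.simple i) -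
        (if cs.length (u * cs.simple i) < cs.length u then
          X * cs.ascPoly prec (fun _ => True) u (v * cs.simple i) else 0) +
        X * cs.ascPoly prec (fun _ => True) u (v * cs.simple i) := by
    intro p hp
    have hp1 := hp.upperConj hM i
    have hp2 := hp1.firstConj hM i (hlast p)
    have hlt : cs.length (v * cs.simple i) < n := by omega
    rw [hp.ascPoly_eq_upperConj hM hi (fun x => by rw [key hp _ _ hlt, key hp1 _ _ hlt]) u,
      hp1.ascPoly_eq_of_simple_last hM (hlast p) hi, key hp1 _ _ hlt, key hp2 _ _ hlt,
      key hp2 _ _ hlt]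
  rw [step h, step h']

end CoxeterSystem
end

/-! ### Independence of the complete cd-index from the reflection ordering -/

noncomputable section

namespace CompleteCD

open Classical

/-- The contribution to the monomial of a path of the steps from its first vertex on, where `t` is
the label of the edge that precedes the first vertex. -/
def labelMonomial {W : Type*} [Group W] (prec : W → W → Prop) : W → List W → Poly
  | t, x :: y :: l =>
      (if prec t (x⁻¹ * y) then a else b) * labelMonomial prec (x⁻¹ * y) (y :: l)
  | _, _ => 1

theorem pathMonomial_cons_cons {W : Type*} [Group W] (prec : W → W → Prop) (x y : W) (l : List W) :
    pathMonomial prec (x :: y :: l) = labelMonomial prec (x⁻¹ * y) (y :: l) := by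
  induction l generalizing x y with
  | nil => rfl
  | cons z l ih => rw [pathMonomial, labelMonomial, ih]

end CompleteCD

namespace CoxeterSystem

open Classical Polynomial CoxeterMatrix CompleteCD

variable {B W : Type*} [Group W] {M : CoxeterMatrix B} (cs : CoxeterSystem M W) [Finite B]

/-- The complete `cd`-index of `[u, v]` with an additional edge with label `t` that ends in `u`. -/
def labelSum (prec : W → W → Prop) (t u v : W) : Poly :=
  ∑ Δ ∈ cs.bruhatPaths u v, labelMonomial prec t Δ

theorem labelSum_eq (prec : W → W → Prop) (t u v : W) (E : Finset W)
    (hE : ∀ y, cs.BruhatEdge u y → cs.BruhatLE y v → y ∈ E) :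
    cs.labelSum prec t u v = (if u = v then 1 else 0) +
      ∑ y ∈ E, if cs.BruhatEdge u y then
        (if prec t (u⁻¹ * y) then a else b) * cs.labelSum prec (u⁻¹ * y) y v else 0 := by
  rw [labelSum, cs.sum_bruhatPaths _ u v E hE]
  congr 1
  refine Finset.sum_congr rfl fun y _ => if_congr Iff.rfl ?_ rfl
  rw [labelSum, Finset.mul_sum]
  refine Finset.sum_congr rfl fun Δ hΔ => ?_
  obtain ⟨l, rfl⟩ := (cs.mem_bruhatPaths.1 hΔ).exists_eq_cons
  rw [labelMonomial]

theorem completeCDIndex_eq (prec : W → W → Prop) (u v : W) (E : Finset W)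
    (hE : ∀ y, cs.BruhatEdge u y → cs.BruhatLE y v → y ∈ E) :
    cs.completeCDIndex prec u v = (if u = v then 1 else 0) +
      ∑ y ∈ E, if cs.BruhatEdge u y then cs.labelSum prec (u⁻¹ * y) y v else 0 := by
  rw [completeCDIndex, cs.sum_bruhatPaths _ u v E hE]
  congr 1
  refine Finset.sum_congr rfl fun y _ => if_congr Iff.rfl ?_ rfl
  rw [labelSum]
  refine Finset.sum_congr rfl fun Δ hΔ => ?_
  obtain ⟨l, rfl⟩ := (cs.mem_bruhatPaths.1 hΔ).exists_eq_cons
  rw [pathMonomial_cons_cons]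

theorem completeCDIndex_self (prec : W → W → Prop) (u : W) : cs.completeCDIndex prec u u = 1 := by
  rw [cs.completeCDIndex_eq prec u u ∅ fun y h1 h2 => absurd h1.length_lt
    (BruhatLE.length_le cs h2).not_gt]
  simp

theorem mem_lengthBall_of_bruhatLE {u v : W} {N : ℕ} (hN : cs.length v ≤ N)
    (h : cs.BruhatLE u v) : u ∈ cs.lengthBall N :=
  cs.mem_lengthBall.2 ((BruhatLE.length_le cs h).trans hN)

/-- The generating function, by number of edges minus one, of the nontrivial paths from `u` to `v`
with increasing labels. -/
def properAscPoly (prec : W → W → Prop) (u v : W) : ℤ[X] :=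
  ∑ y ∈ cs.lengthBall (cs.length v), if cs.BruhatEdge u y then
    cs.ascPoly prec (prec (u⁻¹ * y)) y v else 0

theorem properAscPoly_eq (prec : W → W → Prop) (u v : W) {N : ℕ} (hN : cs.length v ≤ N) :
    cs.properAscPoly prec u v = ∑ y ∈ cs.lengthBall N, if cs.BruhatEdge u y then
      cs.ascPoly prec (prec (u⁻¹ * y)) y v else 0 := by
  refine Finset.sum_subset (fun y hy => ?_) fun y _ hy => ?_
  · rw [mem_lengthBall] at *
    omega
  · rw [mem_lengthBall] at hy
    rw [cs.ascPoly_eq_zero, ite_self]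
    exact fun h => hy (BruhatLE.length_le cs h)

theorem ascPoly_eq_properAscPoly (prec : W → W → Prop) (u v : W) :
    cs.ascPoly prec (fun _ => True) u v =
      (if u = v then 1 else 0) + X * cs.properAscPoly prec u v := by
  rw [cs.ascPoly_eq_ball prec _ u v le_rfl, properAscPoly, Finset.mul_sum]
  congr 1
  refine Finset.sum_congr rfl fun y _ => ?_
  simp

variable {cs}

theorem properAscPoly_independent (hM : M.IsThreeComplete) {prec prec' : W → W → Prop}
    (h : cs.IsReflectionOrdering prec) (h' : cs.IsReflectionOrdering prec') (u v : W) :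
    cs.properAscPoly prec u v = cs.properAscPoly prec' u v := by
  have := ascPoly_independent hM h h' u v
  rw [ascPoly_eq_properAscPoly, ascPoly_eq_properAscPoly] at this
  exact mul_left_cancel₀ X_ne_zero (add_left_cancel this)

variable (cs) in
theorem properAscPoly_eq_zero (prec : W → W → Prop) {u v : W}
    (h : cs.length v ≤ cs.length u) : cs.properAscPoly prec u v = 0 :=
  Finset.sum_eq_zero fun y hy => if_neg fun h1 => by
    have := h1.length_lt
    rw [mem_lengthBall] at hy
    omega

/-- An ascent contributes a = (a - b) + b and any other step b. Let z be the vertex where b is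
chosen for the first time, or z = v if it never is: the path increases up to z, with a factor a - b
for each edge, and is unrestricted afterwards. -/
theorem IsReflectionOrdering.labelSum_eq_sum {prec : W → W → Prop}
    (h : cs.IsReflectionOrdering prec) {t : W} (ht : cs.IsReflection t) (u v : W)
    (hu : cs.length u ≤ cs.length v) :
    cs.labelSum prec t u v = ∑ z ∈ cs.lengthBall (cs.length v),
      aeval (a - b) (cs.ascPoly prec (prec t) u z) *
        if z = v then 1 else b * cs.completeCDIndex prec z v := by
  induction u using cs.bruhat_induction (cs.length v) generalizing t with
  | _ u ih =>
  set N := cs.length v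
  set g : W → Poly := fun z => if z = v then 1 else b * cs.completeCDIndex prec z v with hg
  have hL : cs.labelSum prec t u v = g u + ∑ y ∈ cs.lengthBall N,
      if cs.BruhatEdge u y ∧ prec t (u⁻¹ * y) then
        (a - b) * cs.labelSum prec (u⁻¹ * y) y v else 0 := by
    have hgu : g u = (if u = v then 1 else 0) +
        b * ∑ y ∈ cs.lengthBall N, if cs.BruhatEdge u y then
          cs.labelSum prec (u⁻¹ * y) y v else 0 := by
      have h1 := cs.completeCDIndex_eq prec u v (cs.lengthBall N)
        fun y _ => cs.mem_lengthBall_of_bruhatLE le_rfl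
      rw [hg]
      -- At u = v there are no edges although the index is 1, hence the case distinction in `g`.
      by_cases huv : u = v
      · subst huv
        rw [completeCDIndex_self, if_pos rfl, left_eq_add] at h1
        simp only [if_true, h1, mul_zero, add_zero]
      · simp only [if_neg huv, zero_add] at h1 ⊢
        rw [h1]
    rw [hgu, add_assoc, Finset.mul_sum, ← Finset.sum_add_distrib,
      cs.labelSum_eq prec t u v (cs.lengthBall N) fun y _ => cs.mem_lengthBall_of_bruhatLE le_rfl]
    congr 1
    refine Finset.sum_congr rfl fun y _ => ?_
    by_cases h1 : cs.BruhatEdge u y <;> by_cases h2 : prec t (u⁻¹ * y) <;> simp [h1, h2, sub_mul]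
  have hR : ∀ z ∈ cs.lengthBall N, aeval (a - b) (cs.ascPoly prec (prec t) u z) * g z =
      (if u = z then g z else 0) + ∑ y ∈ cs.lengthBall N,
        if cs.BruhatEdge u y ∧ prec t (u⁻¹ * y) then (a - b) *
          (aeval (a - b) (cs.ascPoly prec (prec (u⁻¹ * y)) y z) * g z) else 0 := by
    intro z hz
    rw [cs.ascPoly_eq_ball prec _ u z (cs.mem_lengthBall.1 hz), map_add, map_sum, add_mul,
      Finset.sum_mul]
    congr 1
    · split_ifs <;> simp
    · refine Finset.sum_congr rfl fun y _ => ?_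
      split_ifs with h1
      · rw [map_mul, aeval_X, mul_assoc]
        congr 3
        refine cs.ascPoly_congr (fun t' ht' => ?_) (fun _ _ _ _ _ _ => Iff.rfl) y z
        exact and_iff_right_of_imp (h.trans _ _ _ ht h1.1.isReflection ht' h1.2)
      · simp
  rw [hL, Finset.sum_congr rfl hR, Finset.sum_add_distrib, Finset.sum_ite_eq,
    if_pos (cs.mem_lengthBall.2 hu), Finset.sum_comm]
  congr 1
  refine Finset.sum_congr rfl fun y hy => ?_
  split_ifs with h1
  · rw [ih y h1.1 (cs.mem_lengthBall.1 hy) h1.1.isReflection (cs.mem_lengthBall.1 hy),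
      Finset.mul_sum]
  · simp

/-- The first edge contributes no factor, so the initial segment is counted by edges minus one. -/
theorem IsReflectionOrdering.completeCDIndex_eq_sum {prec : W → W → Prop}
    (h : cs.IsReflectionOrdering prec) {u v : W} (hne : u ≠ v) :
    cs.completeCDIndex prec u v = ∑ z ∈ cs.lengthBall (cs.length v),
      aeval (a - b) (cs.properAscPoly prec u z) *
        if z = v then 1 else b * cs.completeCDIndex prec z v := by
  have hR : ∀ z ∈ cs.lengthBall (cs.length v), aeval (a - b) (cs.properAscPoly prec u z) *
      (if z = v then 1 else b * cs.completeCDIndex prec z v) =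
      ∑ y ∈ cs.lengthBall (cs.length v), if cs.BruhatEdge u y then
        aeval (a - b) (cs.ascPoly prec (prec (u⁻¹ * y)) y z) *
          (if z = v then 1 else b * cs.completeCDIndex prec z v) else 0 := by
    intro z hz
    rw [cs.properAscPoly_eq prec u z (cs.mem_lengthBall.1 hz), map_sum, Finset.sum_mul]
    refine Finset.sum_congr rfl fun y _ => ?_
    by_cases h1 : cs.BruhatEdge u y
    · rw [if_pos h1, if_pos h1]
    · rw [if_neg h1, if_neg h1, map_zero, zero_mul]
  rw [cs.completeCDIndex_eq prec u v (cs.lengthBall (cs.length v))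
    fun y _ => cs.mem_lengthBall_of_bruhatLE le_rfl, if_neg hne, zero_add,
    Finset.sum_congr rfl hR, Finset.sum_comm]
  refine Finset.sum_congr rfl fun y hy => ?_
  split_ifs with h1
  · rw [h.labelSum_eq_sum h1.isReflection y v (cs.mem_lengthBall.1 hy)]
  · simp

/-- The complete `cd`-index does not depend on the reflection ordering. -/
theorem completeCDIndex_independent (hM : M.IsThreeComplete) {prec prec' : W → W → Prop}
    (h : cs.IsReflectionOrdering prec) (h' : cs.IsReflectionOrdering prec') (u v : W) :
    cs.completeCDIndex prec u v = cs.completeCDIndex prec' u v := by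
  induction hn : cs.length v + 1 - cs.length u using Nat.strong_induction_on generalizing u with
  | _ n ih =>
  by_cases huv : u = v
  · subst huv
    rw [completeCDIndex_self, completeCDIndex_self]
  rw [h.completeCDIndex_eq_sum huv, h'.completeCDIndex_eq_sum huv]
  refine Finset.sum_congr rfl fun z hz => ?_
  rw [mem_lengthBall] at hz
  rw [properAscPoly_independent hM h h']
  -- Only z longer than u contribute, so the expansion is a recursion over smaller intervals.
  rcases le_or_gt (cs.length z) (cs.length u) with h1 | h1
  · rw [cs.properAscPoly_eq_zero _ h1, map_zero, zero_mul, zero_mul]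
  · rw [ih _ (by omega) z rfl]

end CoxeterSystem
end

/-! ### The lexicographic reflection ordering -/

noncomputable section

namespace CoxeterSystem

open CoxeterMatrix

variable {B W : Type*} [Group W] {M : CoxeterMatrix B} {cs : CoxeterSystem M W}

/-- The height of a vector of the root space: the sum of its coordinates. -/
def height : (B →₀ ℝ) →ₗ[ℝ] ℝ := Finsupp.linearCombination ℝ fun _ => (1 : ℝ)

@[simp]
theorem height_simpleRoot (i : B) : height (simpleRoot i) = 1 := by
  simp [height, simpleRoot]

theorem height_eq_sum (β : B →₀ ℝ) : height β = ∑ j ∈ β.support, β j := by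
  simp [height, Finsupp.linearCombination_apply, Finsupp.sum]

theorem height_pos {β : B →₀ ℝ} (h : 0 ≤ β) (h0 : β ≠ 0) : 0 < height β := by
  rw [height_eq_sum]
  refine Finset.sum_pos (fun j hj => ?_) (Finsupp.support_nonempty_iff.2 h0)
  exact lt_of_le_of_ne (h j) (Ne.symm (Finsupp.mem_support_iff.1 hj))

theorem le_height {β : B →₀ ℝ} (h : 0 ≤ β) (i : B) : β i ≤ height β := by
  rw [height_eq_sum]
  by_cases hi : i ∈ β.support
  · exact Finset.single_le_sum (f := fun j => β j) (fun j _ => h j) hi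
  · rw [Finsupp.notMem_support_iff.1 hi]
    exact Finset.sum_nonneg fun j _ => h j

/-- As all off-diagonal entries are 3, 2⟨α_i, β⟩ = 2β_i - Σ_{j≠i} β_j. -/
theorem _root_.CoxeterMatrix.IsThreeComplete.simpleCoroot_eq (hM : M.IsThreeComplete) (i : B)
    (β : B →₀ ℝ) : M.simpleCoroot i β = 3 * β i - height β := by
  classical
  have : M.simpleCoroot i = (3 : ℝ) • Finsupp.lapply i - height := by
    ext j
    by_cases h : i = j
    · subst h
      have := M.simpleCoroot_self i
      simp only [simpleRoot] at this
      simp [height, this]; norm_num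
    · have := hM.simpleCoroot_simpleRoot h
      simp only [simpleRoot] at this
      simp [height, this, Ne.symm h]
  rw [this]
  simp

theorem geometricRep_simple_apply_self (hM : M.IsThreeComplete) (i : B) (β : B →₀ ℝ) :
    cs.geometricRep (cs.simple i) β i = height β - 2 * β i := by
  rw [geometricRep_simple_apply, hM.simpleCoroot_eq]
  simp [simpleRoot]; ring

theorem height_geometricRep_simple (hM : M.IsThreeComplete) (i : B) (β : B →₀ ℝ) :
    height (cs.geometricRep (cs.simple i) β) = 2 * height β - 3 * β i := by
  rw [geometricRep_simple_apply, hM.simpleCoroot_eq]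
  simp; ring

variable {m : ℕ}

/-- The coordinates of `β`, divided by its height, with the lexicographic order. -/
def lexKey (e : B ≃ Fin m) (β : B →₀ ℝ) : Lex (Fin m → ℝ) :=
  toLex fun k => β (e.symm k) / height β

theorem lexKey_lt_iff {e : B ≃ Fin m} {β β' : B →₀ ℝ} :
    lexKey e β < lexKey e β' ↔ ∃ k, (∀ j < k, β (e.symm j) / height β =
      β' (e.symm j) / height β') ∧ β (e.symm k) / height β < β' (e.symm k) / height β' :=
  Iff.rfl

variable (cs) in
/-- The order of reflections by the lexicographic order of their normalized positive roots. -/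
def lexPrec (e : B ≃ Fin m) (t t' : W) : Prop :=
  ∃ β β', cs.IsPositiveRootOf t β ∧ cs.IsPositiveRootOf t' β' ∧ lexKey e β < lexKey e β'

theorem IsPositiveRootOf.lexPrec_iff {e : B ≃ Fin m} {t t' : W} {β β' : B →₀ ℝ}
    (h : cs.IsPositiveRootOf t β) (h' : cs.IsPositiveRootOf t' β') :
    cs.lexPrec e t t' ↔ lexKey e β < lexKey e β' := by
  constructor
  · rintro ⟨γ, γ', hγ, hγ', hlt⟩
    rwa [h.unique hγ, h'.unique hγ']
  · exact fun hlt => ⟨_, _, h, h', hlt⟩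

theorem IsPositiveRootOf.height_pos {t : W} {β : B →₀ ℝ} (h : cs.IsPositiveRootOf t β) :
    0 < height β :=
  CoxeterSystem.height_pos h.nonneg h.ne_zero

theorem IsPositiveRootOf.lexKey_injective (hM : M.IsThreeComplete) {e : B ≃ Fin m} {t t' : W}
    {β β' : B →₀ ℝ} (h : cs.IsPositiveRootOf t β) (h' : cs.IsPositiveRootOf t' β')
    (hk : lexKey e β = lexKey e β') : t = t' := by
  have h1 : β = (height β / height β') • β' := by
    ext j
    have h2 : β j / height β = β' j / height β' := by
      simpa [lexKey] using congrFun (congrArg ofLex hk) (e j)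
    have := h.height_pos.ne'
    have := h'.height_pos.ne'
    rw [Finsupp.smul_apply, smul_eq_mul]
    field_simp at h2 ⊢
    linarith
  have h2 := h.eq_of_eq_smul h' h1
  rw [← h2] at h'
  exact h.reflection_unique hM h'

/-- Scaled to height 1, a positive combination becomes a proper convex combination, which lies
strictly between its endpoints lexicographically. Proportional positive roots coincide, so the order
is total. -/
theorem isReflectionOrdering_lexPrec (hM : M.IsThreeComplete) (e : B ≃ Fin m) :
    cs.IsReflectionOrdering (cs.lexPrec e) := by
  refine ⟨?_, ?_, ?_, ?_⟩
  · intro t ht hp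
    obtain ⟨β, hβ⟩ := ht.exists_isPositiveRootOf hM
    exact lt_irrefl _ ((hβ.lexPrec_iff hβ).1 hp)
  · intro t₁ t₂ t₃ ht₁ ht₂ ht₃ h12 h23
    obtain ⟨β₁, h₁⟩ := ht₁.exists_isPositiveRootOf hM
    obtain ⟨β₂, h₂⟩ := ht₂.exists_isPositiveRootOf hM
    obtain ⟨β₃, h₃⟩ := ht₃.exists_isPositiveRootOf hM
    exact (h₁.lexPrec_iff h₃).2 (((h₁.lexPrec_iff h₂).1 h12).trans ((h₂.lexPrec_iff h₃).1 h23))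
  · intro t₁ t₂ ht₁ ht₂ hne
    obtain ⟨β₁, h₁⟩ := ht₁.exists_isPositiveRootOf hM
    obtain ⟨β₂, h₂⟩ := ht₂.exists_isPositiveRootOf hM
    rw [h₁.lexPrec_iff h₂, h₂.lexPrec_iff h₁]
    exact lt_or_gt_of_ne fun hk => hne (h₁.lexKey_injective hM h₂ hk)
  · intro t₁ t₂ t β₁ β₂ β c₁ c₂ h₁ h₂ ht hc₁ hc₂ hβ hp
    rw [h₁.lexPrec_iff h₂, lexKey_lt_iff] at hp
    rw [h₁.lexPrec_iff ht, ht.lexPrec_iff h₂, lexKey_lt_iff, lexKey_lt_iff]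
    obtain ⟨k, hk1, hk2⟩ := hp
    have p₁ := h₁.height_pos
    have p₂ := h₂.height_pos
    have hh : height β = c₁ * height β₁ + c₂ * height β₂ := by simp [hβ]
    have p : 0 < height β := ht.height_pos
    -- The coefficient is the weight of β₂ in the convex combination of the scaled roots.
    have hj : ∀ j, β j / height β = β₁ j / height β₁ +
        (c₂ * height β₂ / height β) * (β₂ j / height β₂ - β₁ j / height β₁) := by
      intro j
      have : β j = c₁ * β₁ j + c₂ * β₂ j := by simp [hβ]
      rw [this]
      field_simp
      rw [hh]
      ring
    have hj' : ∀ j, β j / height β = β₂ j / height β₂ -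
        (c₁ * height β₁ / height β) * (β₂ j / height β₂ - β₁ j / height β₁) := by
      intro j
      have : β j = c₁ * β₁ j + c₂ * β₂ j := by simp [hβ]
      rw [this]
      field_simp
      rw [hh]
      ring
    refine ⟨⟨k, fun j hlt => ?_, ?_⟩, ⟨k, fun j hlt => ?_, ?_⟩⟩
    · rw [hj, hk1 j hlt]; ring
    · rw [hj, lt_add_iff_pos_right]
      exact mul_pos (by positivity) (sub_pos.2 hk2)
    · rw [hj', hk1 j hlt]; ring
    · rw [hj', sub_lt_self_iff]
      exact mul_pos (by positivity) (sub_pos.2 hk2)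

theorem lexKey_lt_of_first {e : B ≃ Fin (m + 1)} {i : B} (he : e i = 0) {β β' : B →₀ ℝ}
    (h : β i / height β < β' i / height β') : lexKey e β < lexKey e β' := by
  refine lexKey_lt_iff.2 ⟨0, fun j hj => absurd hj (Fin.not_lt_zero j), ?_⟩
  rwa [← he, Equiv.symm_apply_apply]

/-- On scaled roots with vanishing i-th coordinate, s_i acts as γ ↦ (γ + α_i)/2, which preserves the
lexicographic order. -/
theorem lexPrec_simple_conj_iff (hM : M.IsThreeComplete) {e : B ≃ Fin m} {i : B} {t t' : W}
    {β β' : B →₀ ℝ} (h : cs.IsPositiveRootOf t β) (h' : cs.IsPositiveRootOf t' β')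
    (hi : β i = 0) (hi' : β' i = 0) (hne : t ≠ cs.simple i) (hne' : t' ≠ cs.simple i) :
    cs.lexPrec e (cs.simple i * t * cs.simple i) (cs.simple i * t' * cs.simple i) ↔
      cs.lexPrec e t t' := by
  have p := h.height_pos
  have p' := h'.height_pos
  rw [(h.simple_conj hM hne).lexPrec_iff (h'.simple_conj hM hne'), h.lexPrec_iff h',
    lexKey_lt_iff, lexKey_lt_iff]
  have key : ∀ {γ : B →₀ ℝ}, γ i = 0 → 0 < height γ → ∀ j,
      cs.geometricRep (cs.simple i) γ j / height (cs.geometricRep (cs.simple i) γ) =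
        γ j / height γ / 2 + (simpleRoot i : B →₀ ℝ) j / 2 := by
    intro γ hγ hp j
    rw [height_geometricRep_simple hM, hγ]
    by_cases hj : j = i
    · subst hj
      rw [geometricRep_simple_apply_self hM, hγ]
      simp [simpleRoot]
      field_simp
    · rw [geometricRep_simple_apply_of_ne cs hj]
      simp [simpleRoot, Ne.symm hj]
      field_simp
  simp only [key hi p, key hi' p', add_left_inj, add_lt_add_iff_right]
  refine exists_congr fun k => and_congr (forall_congr' fun j => forall_congr' fun _ => ?_) ?_
  · constructor <;> intro h <;> linarith
  · constructor <;> intro h <;> linarith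

end CoxeterSystem
end

/-! ### The parabolic subgroup W_J and the elements below svs -/

noncomputable section

namespace CoxeterSystem

open CoxeterMatrix

variable {B W : Type*} [Group W] {M : CoxeterMatrix B} {cs : CoxeterSystem M W}

variable (cs) in
/-- The standard parabolic subgroup that is generated by the simple reflections other than `i`. -/
def avoiding (i : B) : Subgroup W where
  carrier := {x | ∃ ω : List B, i ∉ ω ∧ cs.wordProd ω = x}
  mul_mem' := by
    rintro _ _ ⟨ω, h, rfl⟩ ⟨ω', h', rfl⟩
    exact ⟨ω ++ ω', by simp [h, h'], cs.wordProd_append _ _⟩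
  one_mem' := ⟨[], by simp, by simp⟩
  inv_mem' := by
    rintro _ ⟨ω, h, rfl⟩
    exact ⟨ω.reverse, by simpa using h, by simp⟩

theorem mem_avoiding {i : B} {x : W} :
    x ∈ cs.avoiding i ↔ ∃ ω : List B, i ∉ ω ∧ cs.wordProd ω = x := Iff.rfl

theorem geometricRep_apply_of_mem_avoiding {i : B} {x : W} (hx : x ∈ cs.avoiding i)
    (γ : B →₀ ℝ) : cs.geometricRep x γ i = γ i := by
  obtain ⟨ω, h, rfl⟩ := hx
  induction ω with
  | nil => rw [wordProd_nil, geometricRep_one_apply]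
  | cons j ω ih =>
    simp only [List.mem_cons, not_or] at h
    rw [wordProd_cons, geometricRep_mul_apply, geometricRep_simple_apply_of_ne cs h.1, ih h.2]

theorem geometricRep_simpleRoot_apply_of_mem_avoiding {i : B} {x : W} (hx : x ∈ cs.avoiding i) :
    cs.geometricRep x (simpleRoot i) i = 1 := by
  rw [geometricRep_apply_of_mem_avoiding hx]
  simp [simpleRoot]

theorem simple_notMem_avoiding (i : B) : cs.simple i ∉ cs.avoiding i := fun h => by
  have := geometricRep_simpleRoot_apply_of_mem_avoiding h
  rw [geometricRep_simple_self] at this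
  norm_num [simpleRoot] at this

theorem IsPositiveRootOf.apply_eq_zero_of_mem_avoiding {i : B} {t : W} {β : B →₀ ℝ}
    (h : cs.IsPositiveRootOf t β) (ht : t ∈ cs.avoiding i) : β i = 0 := by
  have := geometricRep_apply_of_mem_avoiding ht β
  rw [h.geometricRep_self, Finsupp.neg_apply] at this
  linarith

theorem geometricRep_simpleRoot_nonneg_of_mem_avoiding (hM : M.IsThreeComplete) {i : B} {x : W}
    (hx : x ∈ cs.avoiding i) : 0 ≤ cs.geometricRep x (simpleRoot i) := by
  refine (cs.geometricRep_simpleRoot_nonneg_or_nonpos hM x i).resolve_right fun h => ?_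
  have := h i
  rw [geometricRep_simpleRoot_apply_of_mem_avoiding hx, Finsupp.coe_zero, Pi.zero_apply] at this
  linarith

theorem length_mul_simple_of_mem_avoiding (hM : M.IsThreeComplete) {i : B} {x : W}
    (hx : x ∈ cs.avoiding i) : cs.length (x * cs.simple i) = cs.length x + 1 := by
  have := (cs.isPositiveRootOf_simple i).length_lt_mul hM
    (geometricRep_simpleRoot_nonneg_of_mem_avoiding hM hx)
  have := cs.length_mul_simple x i
  omega

theorem length_simple_mul_of_mem_avoiding (hM : M.IsThreeComplete) {i : B} {x : W}
    (hx : x ∈ cs.avoiding i) : cs.length (cs.simple i * x) = cs.length x + 1 := by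
  have := length_mul_simple_of_mem_avoiding hM (inv_mem hx)
  rw [← length_inv] at this
  simpa using this

/-- For a right descent s_j of x and x = y s_j, the root x α_i is the sum of y α_i, whose i-th
coordinate is 1, and the positive root y α_j. -/
theorem one_lt_height_of_mem_avoiding (hM : M.IsThreeComplete) {i : B} {x : W}
    (hx : x ∈ cs.avoiding i) (h1 : x ≠ 1) :
    1 < height (cs.geometricRep x (simpleRoot i)) := by
  obtain ⟨j, hj⟩ := cs.exists_rightDescent_of_ne_one h1
  rw [IsRightDescent] at hj
  have hij : j ≠ i := by
    rintro rfl
    rw [length_mul_simple_of_mem_avoiding hM hx] at hj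
    omega
  obtain ⟨y, rfl⟩ : ∃ y, x = y * cs.simple j := ⟨x * cs.simple j, by simp⟩
  have hy : y ∈ cs.avoiding i := by
    refine (Subgroup.mul_mem_cancel_right _ (mem_avoiding.2 ⟨[j], by simpa using hij.symm, by simp⟩)).1 hx
  rw [simple_mul_simple_cancel_right] at hj
  rw [geometricRep_mul_apply, cs.geometricRep_simple_simpleRoot hM hij, map_add, map_add]
  have h2 := height_pos (cs.geometricRep_simpleRoot_nonneg hM y j hj)
    (cs.geometricRep_simpleRoot_ne_zero y j)
  have h3 := le_height (geometricRep_simpleRoot_nonneg_of_mem_avoiding hM hy) i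
  rw [geometricRep_simpleRoot_apply_of_mem_avoiding hy] at h3
  linarith

/-- If h is the height of x α_i, then s x α_i has i-th coordinate h - 2 and height 2h - 3. Were it
negative, 2 - h ≤ 3 - 2h would follow, against h > 1. -/
theorem length_simple_mul_simple_of_mem_avoiding (hM : M.IsThreeComplete) {i : B} {x : W}
    (hx : x ∈ cs.avoiding i) (h1 : x ≠ 1) :
    cs.length (cs.simple i * x * cs.simple i) = cs.length x + 2 := by
  have h2 := one_lt_height_of_mem_avoiding hM hx h1
  have h3 := geometricRep_simpleRoot_apply_of_mem_avoiding hx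
  have h4 : 0 ≤ cs.geometricRep (cs.simple i * x) (simpleRoot i) := by
    refine (cs.geometricRep_simpleRoot_nonneg_or_nonpos hM _ i).resolve_right fun h => ?_
    have h5 : height (-cs.geometricRep (cs.simple i * x) (simpleRoot i)) ≥
        (-cs.geometricRep (cs.simple i * x) (simpleRoot i)) i := le_height (neg_nonneg.2 h) i
    rw [geometricRep_mul_apply, map_neg, height_geometricRep_simple hM, Finsupp.neg_apply,
      geometricRep_simple_apply_self hM, h3] at h5
    linarith
  have := (cs.isPositiveRootOf_simple i).length_lt_mul hM h4
  have := cs.length_mul_simple (cs.simple i * x) i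
  have := length_simple_mul_of_mem_avoiding hM hx
  omega

/-- Otherwise y = sxs and x = sys would each be longer than the other by 2. -/
theorem eq_one_of_simple_mul_eq_mul_simple (hM : M.IsThreeComplete) {i : B} {x y : W}
    (hx : x ∈ cs.avoiding i) (hy : y ∈ cs.avoiding i)
    (h : cs.simple i * x = y * cs.simple i) : x = 1 := by
  by_contra h1
  have e1 : cs.simple i * x * cs.simple i = y := by rw [h, simple_mul_simple_cancel_right]
  have e2 : cs.simple i * y * cs.simple i = x := by rw [← e1, simple_conj_conj]
  have l1 := length_simple_mul_simple_of_mem_avoiding hM hx h1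
  have l2 := length_simple_mul_simple_of_mem_avoiding hM hy (by
    rintro rfl
    exact h1 (e2.symm.trans (by simp)))
  rw [e1] at l1
  rw [e2] at l2
  omega

theorem eq_one_of_mul_simple_eq_simple_mul (hM : M.IsThreeComplete) {i : B} {x y : W}
    (hx : x ∈ cs.avoiding i) (hy : y ∈ cs.avoiding i)
    (h : x * cs.simple i = cs.simple i * y) : x = 1 := by
  obtain rfl := eq_one_of_simple_mul_eq_mul_simple hM hy hx h.symm
  rw [mul_one, mul_eq_right] at h
  exact h

theorem simple_mul_notMem_avoiding {i : B} {x : W} (hx : x ∈ cs.avoiding i) :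
    cs.simple i * x ∉ cs.avoiding i := fun h =>
  simple_notMem_avoiding i ((Subgroup.mul_mem_cancel_right _ hx).1 h)

theorem mul_simple_notMem_avoiding {i : B} {x : W} (hx : x ∈ cs.avoiding i) :
    x * cs.simple i ∉ cs.avoiding i := fun h =>
  simple_notMem_avoiding i ((Subgroup.mul_mem_cancel_left _ hx).1 h)

theorem simple_mul_mul_simple_notMem_avoiding (hM : M.IsThreeComplete) {i : B} {x : W}
    (hx : x ∈ cs.avoiding i) (h1 : x ≠ 1) : cs.simple i * x * cs.simple i ∉ cs.avoiding i :=
  fun h => h1 (eq_one_of_simple_mul_eq_mul_simple hM hx h (by simp))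

theorem BruhatEdge.exists_eraseIdx (hM : M.IsThreeComplete) {x : W} {ω : List B}
    (h : cs.BruhatEdge x (cs.wordProd ω)) :
    ∃ k < ω.length, x = cs.wordProd (ω.eraseIdx k) := by
  have hr := h.isReflection
  have e : cs.wordProd ω * (x⁻¹ * cs.wordProd ω)⁻¹ = x := by group
  rw [hr.inv] at e
  obtain ⟨k, hk, e'⟩ := hr.exists_eraseIdx hM (ω := ω) (by rw [e]; exact h.length_lt)
  exact ⟨k, hk, e.symm.trans e'⟩

theorem BruhatEdge.mem_avoiding (hM : M.IsThreeComplete) {i : B} {x y : W}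
    (h : cs.BruhatEdge x y) (hy : y ∈ cs.avoiding i) : x ∈ cs.avoiding i := by
  obtain ⟨ω, hω, rfl⟩ := hy
  obtain ⟨k, -, rfl⟩ := h.exists_eraseIdx hM
  exact ⟨_, fun hm => hω (List.mem_of_mem_eraseIdx hm), rfl⟩

theorem BruhatLE.mem_avoiding (hM : M.IsThreeComplete) {i : B} {x y : W}
    (h : cs.BruhatLE x y) (hy : y ∈ cs.avoiding i) : x ∈ cs.avoiding i := by
  induction h with
  | refl => exact hy
  | tail _ h ih => exact ih (h.mem_avoiding hM hy)

/-- By strong exchange, z arises from a word of sy by deleting either the leading s or a letter of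
y. -/
theorem BruhatEdge.of_simple_mul (hM : M.IsThreeComplete) {i : B} {z y : W}
    (h : cs.BruhatEdge z (cs.simple i * y)) (hy : y ∈ cs.avoiding i) :
    z = y ∨ ∃ x ∈ cs.avoiding i, z = cs.simple i * x := by
  obtain ⟨ω, hω, rfl⟩ := hy
  rw [← wordProd_cons] at h
  obtain ⟨k, hk, rfl⟩ := h.exists_eraseIdx hM
  cases k with
  | zero => exact .inl (by simp)
  | succ k =>
    exact .inr ⟨_, ⟨ω.eraseIdx k, fun hm => hω (List.mem_of_mem_eraseIdx hm), rfl⟩, by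
      simp [wordProd_cons]⟩

theorem bruhatEdge_inv_iff {x y : W} : cs.BruhatEdge x⁻¹ y⁻¹ ↔ cs.BruhatEdge x y := by
  have key : ∀ {x y : W}, cs.BruhatEdge x y → cs.BruhatEdge x⁻¹ y⁻¹ := by
    rintro x _ ⟨t, ht, rfl, hl⟩
    refine bruhatEdge_iff.2 ⟨by simpa [ht.inv] using ht, ?_⟩
    rwa [length_inv, length_inv]
  exact ⟨fun h => by simpa using key h, key⟩

theorem BruhatEdge.of_mul_simple (hM : M.IsThreeComplete) {i : B} {z y : W}
    (h : cs.BruhatEdge z (y * cs.simple i)) (hy : y ∈ cs.avoiding i) :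
    z = y ∨ ∃ x ∈ cs.avoiding i, z = x * cs.simple i := by
  have h' : cs.BruhatEdge z⁻¹ (cs.simple i * y⁻¹) := by
    rw [← bruhatEdge_inv_iff]
    simpa using h
  rcases h'.of_simple_mul hM (inv_mem hy) with h1 | ⟨x, hx, h1⟩
  · exact .inl (inv_injective h1)
  · exact .inr ⟨x⁻¹, inv_mem hx, inv_injective (by simpa using h1)⟩

theorem BruhatEdge.of_simple_mul_simple (hM : M.IsThreeComplete) {i : B} {z y : W}
    (h : cs.BruhatEdge z (cs.simple i * y * cs.simple i)) (hy : y ∈ cs.avoiding i) :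
    z = cs.simple i * y ∨ z = y * cs.simple i ∨
      ∃ x ∈ cs.avoiding i, z = cs.simple i * x * cs.simple i := by
  obtain ⟨ω, hω, rfl⟩ := hy
  have e : cs.simple i * cs.wordProd ω * cs.simple i = cs.wordProd (i :: (ω ++ [i])) := by
    simp [wordProd_cons, wordProd_append, mul_assoc]
  rw [e] at h
  obtain ⟨k, hk, rfl⟩ := h.exists_eraseIdx hM
  cases k with
  | zero => exact .inr (.inl (by simp [wordProd_append]))
  | succ k =>
    simp only [List.length_cons, List.length_append, List.length_nil] at hk
    rw [List.eraseIdx_cons_succ]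
    by_cases hk' : k < ω.length
    · rw [List.eraseIdx_append_of_lt_length hk']
      exact .inr (.inr ⟨_, ⟨ω.eraseIdx k, fun hm => hω (List.mem_of_mem_eraseIdx hm), rfl⟩, by
        simp [wordProd_cons, wordProd_append, mul_assoc]⟩)
    · obtain rfl : k = ω.length := by omega
      rw [List.eraseIdx_append_of_length_le le_rfl]
      exact .inl (by simp [wordProd_cons])

theorem bruhatEdge_simple_mul_iff (hM : M.IsThreeComplete) {i : B} {x y : W}
    (hx : x ∈ cs.avoiding i) (hy : y ∈ cs.avoiding i) :
    cs.BruhatEdge (cs.simple i * x) (cs.simple i * y) ↔ cs.BruhatEdge x y := by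
  rw [bruhatEdge_iff, bruhatEdge_iff, length_simple_mul_of_mem_avoiding hM hx,
    length_simple_mul_of_mem_avoiding hM hy, add_lt_add_iff_right]
  simp [mul_assoc]

theorem bruhatEdge_mul_simple_mul_simple_iff (hM : M.IsThreeComplete) {i : B} {x y : W}
    (hx : x ∈ cs.avoiding i) (hy : y ∈ cs.avoiding i) :
    cs.BruhatEdge (x * cs.simple i) (y * cs.simple i) ↔ cs.BruhatEdge x y := by
  have := bruhatEdge_simple_mul_iff hM (inv_mem hx) (inv_mem hy)
  rw [bruhatEdge_inv_iff, ← bruhatEdge_inv_iff] at this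
  simpa using this

theorem bruhatEdge_simple_conj_iff (hM : M.IsThreeComplete) {i : B} {x y : W}
    (hx : x ∈ cs.avoiding i) (hy : y ∈ cs.avoiding i) (hx1 : x ≠ 1) (hy1 : y ≠ 1) :
    cs.BruhatEdge (cs.simple i * x * cs.simple i) (cs.simple i * y * cs.simple i) ↔
      cs.BruhatEdge x y := by
  rw [bruhatEdge_iff, bruhatEdge_iff, length_simple_mul_simple_of_mem_avoiding hM hx hx1,
    length_simple_mul_simple_of_mem_avoiding hM hy hy1, add_lt_add_iff_right]
  have e : (cs.simple i * x * cs.simple i)⁻¹ * (cs.simple i * y * cs.simple i) =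
      cs.simple i * (x⁻¹ * y) * (cs.simple i)⁻¹ := by simp [mul_assoc]
  rw [e, isReflection_conj_iff]

theorem not_bruhatEdge_one (x : W) : ¬ cs.BruhatEdge x 1 := fun h => by
  have := h.length_lt
  simp at this

theorem bruhatLE_mul_wordProd {x : W} {ω : List B}
    (h : cs.length (x * cs.wordProd ω) = cs.length x + ω.length) :
    cs.BruhatLE x (x * cs.wordProd ω) := by
  induction ω generalizing x with
  | nil => simpa using .refl
  | cons i ω ih =>
    rw [wordProd_cons, ← mul_assoc, List.length_cons] at *
    have h1 := cs.length_mul_le (x * cs.simple i) (cs.wordProd ω)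
    have h2 := cs.length_wordProd_le ω
    have h3 := cs.length_mul_simple x i
    exact .head (bruhatEdge_mul_simple_iff.2 (by omega)) (ih (by omega))

theorem one_bruhatLE (x : W) : cs.BruhatLE 1 x := by
  obtain ⟨ω, hω, rfl⟩ := cs.exists_isReduced x
  simpa using bruhatLE_mul_wordProd (cs := cs) (x := 1) (ω := ω) (by simpa using hω.eq)

/-- The elements below `s y s`, where `y` avoids `s`. -/
theorem BruhatLE.of_simple_mul_simple (hM : M.IsThreeComplete) {i : B} {w v : W}
    (h : cs.BruhatLE w (cs.simple i * v * cs.simple i)) (hv : v ∈ cs.avoiding i) :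
    ∃ y, cs.BruhatLE y v ∧ (w = y ∨ w = cs.simple i * y ∨ w = y * cs.simple i ∨
      w = cs.simple i * y * cs.simple i) := by
  induction h using Relation.ReflTransGen.head_induction_on with
  | refl => exact ⟨v, .refl, by simp⟩
  | @head w w' hw _ ih =>
    obtain ⟨y, hy, h⟩ := ih
    have hyV := hy.mem_avoiding hM hv
    rcases h with rfl | rfl | rfl | rfl
    · exact ⟨w, .head hw hy, .inl rfl⟩
    · rcases hw.of_simple_mul hM hyV with rfl | ⟨x, hx, rfl⟩
      · exact ⟨_, hy, .inl rfl⟩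
      · exact ⟨x, .head ((bruhatEdge_simple_mul_iff hM hx hyV).1 hw) hy, by simp⟩
    · rcases hw.of_mul_simple hM hyV with rfl | ⟨x, hx, rfl⟩
      · exact ⟨_, hy, .inl rfl⟩
      · exact ⟨x, .head ((bruhatEdge_mul_simple_mul_simple_iff hM hx hyV).1 hw) hy, by simp⟩
    · by_cases hy1 : y = 1
      · subst hy1
        simp only [mul_one, simple_mul_simple_self] at hw
        exact absurd hw (not_bruhatEdge_one w)
      rcases hw.of_simple_mul_simple hM hyV with rfl | rfl | ⟨x, hx, rfl⟩
      · exact ⟨y, hy, by simp⟩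
      · exact ⟨y, hy, by simp⟩
      -- For x = e the vertex sxs degenerates to e, where conjugation does not reflect edges.
      · by_cases hx1 : x = 1
        · subst hx1
          exact ⟨1, one_bruhatLE v, by simp⟩
        · exact ⟨x, .head ((bruhatEdge_simple_conj_iff hM hx hyV hx1 hy1).1 hw) hy, by simp⟩

theorem bruhatLE_wordProd_mul_simple (hM : M.IsThreeComplete) {i : B} {ω : List B} (hω : i ∉ ω)
    (h : cs.IsReduced ω) : cs.BruhatLE (cs.simple i) (cs.wordProd ω * cs.simple i) := by
  induction ω with
  | nil => simpa using .refl
  | cons j ω ih =>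
    have hr : cs.IsReduced ω := by simpa using h.drop 1
    simp only [List.mem_cons, not_or] at hω
    refine .tail (ih hω.2 hr) ((bruhatEdge_mul_simple_mul_simple_iff hM ⟨ω, hω.2, rfl⟩
      ⟨j :: ω, by simpa using hω, rfl⟩).2 ⟨_, cs.isReflection_simple j, cs.wordProd_cons j ω, ?_⟩)
    rw [hr.eq, h.eq]
    simp

theorem mem_avoiding_of_not_bruhatLE (hM : M.IsThreeComplete) {i : B} {v : W}
    (h : ¬ cs.BruhatLE (cs.simple i) v) : v ∈ cs.avoiding i := by
  obtain ⟨ω, hω, rfl⟩ := cs.exists_isReduced v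
  refine ⟨ω, fun hi => h ?_, rfl⟩
  -- Cut at the first occurrence of s: the prefix avoids s, so s ≤ ω₁ s ≤ v.
  obtain ⟨ω₁, ω₂, rfl, hi₁⟩ := List.eq_append_cons_of_mem hi
  have h1 : cs.IsReduced ω₁ := by simpa using hω.take ω₁.length
  have h2 := bruhatLE_wordProd_mul_simple hM hi₁ h1
  refine h2.trans ?_
  have e : cs.wordProd (ω₁ ++ i :: ω₂) = cs.wordProd ω₁ * cs.simple i * cs.wordProd ω₂ := by
    simp [wordProd_append, wordProd_cons, mul_assoc]
  have h3 := hω.eq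
  rw [e] at h3 ⊢
  refine bruhatLE_mul_wordProd (h3.trans ?_)
  have := length_mul_simple_of_mem_avoiding hM (mem_avoiding (cs := cs).2 ⟨ω₁, hi₁, rfl⟩)
  rw [this, h1.eq]
  simp; omega

end CoxeterSystem
end

/-! ### Comparison of the paths in [s, svs] with those in [e, v] -/

noncomputable section

namespace CoxeterSystem

open Classical CoxeterMatrix CompleteCD

variable {B W : Type*} [Group W] {M : CoxeterMatrix B} {cs : CoxeterSystem M W}

/-- The properties of the reflection ordering that are used to compare paths in `W_J` with their
images under left and right multiplication by the simple reflection `s` outside `J`. -/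
structure IsAdapted (cs : CoxeterSystem M W) (i : B) (prec : W → W → Prop) : Prop where
  conj_iff : ∀ t ∈ cs.avoiding i, ∀ t' ∈ cs.avoiding i, cs.IsReflection t → cs.IsReflection t' →
    (prec (cs.simple i * t * cs.simple i) (cs.simple i * t' * cs.simple i) ↔ prec t t')
  lt_simple : ∀ t ∈ cs.avoiding i, cs.IsReflection t → prec t (cs.simple i)
  not_simple_lt_conj : ∀ t ∈ cs.avoiding i, cs.IsReflection t →
    ¬ prec (cs.simple i) (cs.simple i * t * cs.simple i)
  lt_conj : ∀ x ∈ cs.avoiding i, x ≠ 1 → ∀ t ∈ cs.avoiding i, cs.IsReflection t →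
    prec (cs.simple i * (x⁻¹ * cs.simple i * x) * cs.simple i) (cs.simple i * t * cs.simple i)
  not_conj_lt : ∀ x ∈ cs.avoiding i, x ≠ 1 → ∀ t ∈ cs.avoiding i, cs.IsReflection t →
    ¬ prec (cs.simple i * t * cs.simple i) (cs.simple i * (x⁻¹ * cs.simple i * x) * cs.simple i)

theorem ne_simple_of_mem_avoiding {i : B} {t : W} (ht : t ∈ cs.avoiding i) : t ≠ cs.simple i := by
  rintro rfl
  exact simple_notMem_avoiding i ht

/-- The scaled i-th coordinate is compared first. It is 0 for t in W_J, 1 for s, 1/2 for sts, and (h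
- 2)/(2h - 3) < 1/2 for the crossing label, where h > 1 is the height of x⁻¹α_s. Ties between
conjugates of reflections of W_J are settled by `lexPrec_simple_conj_iff`. -/
theorem isAdapted_lexPrec (hM : M.IsThreeComplete) {m : ℕ} {e : B ≃ Fin (m + 1)} {i : B}
    (he : e i = 0) : cs.IsAdapted i (cs.lexPrec e) := by
  have hi := cs.isPositiveRootOf_simple i
  have half : ∀ {t β}, t ∈ cs.avoiding i → cs.IsPositiveRootOf t β →
      cs.geometricRep (cs.simple i) β i / height (cs.geometricRep (cs.simple i) β) = 1 / 2 := by
    intro t β ht hβ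
    have := hβ.height_pos
    rw [geometricRep_simple_apply_self hM, height_geometricRep_simple hM,
      hβ.apply_eq_zero_of_mem_avoiding ht]
    field_simp
    ring
  have one : (simpleRoot i : B →₀ ℝ) i / height (simpleRoot i) = 1 := by
    rw [height_simpleRoot]
    simp [simpleRoot]
  have hlt : ∀ x ∈ cs.avoiding i, x ≠ 1 → ∀ t ∈ cs.avoiding i, ∀ β, cs.IsPositiveRootOf t β →
      ∃ γ, cs.IsPositiveRootOf (cs.simple i * (x⁻¹ * cs.simple i * x) * cs.simple i) γ ∧
        lexKey e γ < lexKey e (cs.geometricRep (cs.simple i) β) := by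
    intro x hx hx1 t ht β hβ
    have hx' := inv_mem hx
    have h1 := one_lt_height_of_mem_avoiding hM hx' (inv_ne_one.2 hx1)
    have h2 := geometricRep_simpleRoot_apply_of_mem_avoiding hx'
    have h3 := hi.conj (geometricRep_simpleRoot_nonneg_of_mem_avoiding hM hx')
    rw [inv_inv] at h3
    have h4 : x⁻¹ * cs.simple i * x ≠ cs.simple i := by
      intro h
      rw [h] at h3
      rw [h3.unique hi, height_simpleRoot] at h1
      exact lt_irrefl _ h1
    refine ⟨_, h3.simple_conj hM h4, lexKey_lt_of_first he ?_⟩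
    rw [half ht hβ]
    have h5 := (h3.simple_conj hM h4).height_pos
    rw [height_geometricRep_simple hM, h2] at h5
    rw [geometricRep_simple_apply_self hM, height_geometricRep_simple hM, h2,
      div_lt_div_iff₀ h5 two_pos]
    linarith
  refine ⟨?_, ?_, ?_, ?_, ?_⟩
  · intro t ht t' ht' hr hr'
    obtain ⟨β, hβ⟩ := hr.exists_isPositiveRootOf hM
    obtain ⟨β', hβ'⟩ := hr'.exists_isPositiveRootOf hM
    exact lexPrec_simple_conj_iff hM hβ hβ' (hβ.apply_eq_zero_of_mem_avoiding ht)
      (hβ'.apply_eq_zero_of_mem_avoiding ht') (ne_simple_of_mem_avoiding ht)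
      (ne_simple_of_mem_avoiding ht')
  · intro t ht hr
    obtain ⟨β, hβ⟩ := hr.exists_isPositiveRootOf hM
    refine (hβ.lexPrec_iff hi).2 (lexKey_lt_of_first he ?_)
    rw [one, hβ.apply_eq_zero_of_mem_avoiding ht]
    norm_num
  · intro t ht hr
    obtain ⟨β, hβ⟩ := hr.exists_isPositiveRootOf hM
    rw [hi.lexPrec_iff (hβ.simple_conj hM (ne_simple_of_mem_avoiding ht))]
    refine (lexKey_lt_of_first he ?_).not_gt
    rw [one, half ht hβ]
    norm_num
  · intro x hx hx1 t ht hr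
    obtain ⟨β, hβ⟩ := hr.exists_isPositiveRootOf hM
    obtain ⟨γ, hγ, h⟩ := hlt x hx hx1 t ht β hβ
    exact (hγ.lexPrec_iff (hβ.simple_conj hM (ne_simple_of_mem_avoiding ht))).2 h
  · intro x hx hx1 t ht hr
    obtain ⟨β, hβ⟩ := hr.exists_isPositiveRootOf hM
    obtain ⟨γ, hγ, h⟩ := hlt x hx hx1 t ht β hβ
    rw [(hβ.simple_conj hM (ne_simple_of_mem_avoiding ht)).lexPrec_iff hγ]
    exact h.not_gt

/-! ### Edges inside [s, svs] -/

section Edges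

variable {i : B} {v w x : W}

theorem BruhatEdge.from_simple_conj (hM : M.IsThreeComplete) (hv : v ∈ cs.avoiding i)
    (hx : x ∈ cs.avoiding i) (hx1 : x ≠ 1)
    (h : cs.BruhatEdge (cs.simple i * x * cs.simple i) w)
    (hw : cs.BruhatLE w (cs.simple i * v * cs.simple i)) :
    ∃ y, cs.BruhatLE y v ∧ w = cs.simple i * y * cs.simple i := by
  obtain ⟨y, hy, rfl | rfl | rfl | rfl⟩ := hw.of_simple_mul_simple hM hv
  · exact absurd (h.mem_avoiding hM (hy.mem_avoiding hM hv))
      (simple_mul_mul_simple_notMem_avoiding hM hx hx1)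
  · rcases h.of_simple_mul hM (hy.mem_avoiding hM hv) with rfl | ⟨y', hy', e⟩
    · exact absurd (hy.mem_avoiding hM hv) (simple_mul_mul_simple_notMem_avoiding hM hx hx1)
    · rw [mul_assoc, mul_left_cancel_iff] at e
      exact absurd (e ▸ hy') (mul_simple_notMem_avoiding hx)
  · rcases h.of_mul_simple hM (hy.mem_avoiding hM hv) with rfl | ⟨y', hy', e⟩
    · exact absurd (hy.mem_avoiding hM hv) (simple_mul_mul_simple_notMem_avoiding hM hx hx1)
    · rw [mul_right_cancel_iff] at e
      exact absurd (e ▸ hy') (simple_mul_notMem_avoiding hx)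
  · exact ⟨y, hy, rfl⟩

theorem BruhatEdge.from_simple_mul (hM : M.IsThreeComplete) (hv : v ∈ cs.avoiding i)
    (hx : x ∈ cs.avoiding i) (hx1 : x ≠ 1)
    (h : cs.BruhatEdge (cs.simple i * x) w)
    (hw : cs.BruhatLE w (cs.simple i * v * cs.simple i)) :
    w = cs.simple i * x * cs.simple i ∨ ∃ y, cs.BruhatLE y v ∧ w = cs.simple i * y := by
  obtain ⟨y, hy, rfl | rfl | rfl | rfl⟩ := hw.of_simple_mul_simple hM hv
  · exact absurd (h.mem_avoiding hM (hy.mem_avoiding hM hv)) (simple_mul_notMem_avoiding hx)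
  · exact .inr ⟨y, hy, rfl⟩
  · rcases h.of_mul_simple hM (hy.mem_avoiding hM hv) with rfl | ⟨y', hy', e⟩
    · exact absurd (hy.mem_avoiding hM hv) (simple_mul_notMem_avoiding hx)
    · exact absurd (eq_one_of_simple_mul_eq_mul_simple hM hx hy' e) hx1
  · rcases h.of_simple_mul_simple hM (hy.mem_avoiding hM hv) with e | e | ⟨y', hy', e⟩
    · rw [mul_left_cancel_iff] at e
      exact .inl (by rw [e])
    · exact absurd (eq_one_of_simple_mul_eq_mul_simple hM hx (hy.mem_avoiding hM hv) e) hx1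
    · rw [mul_assoc, mul_left_cancel_iff] at e
      exact absurd (e ▸ hx) (mul_simple_notMem_avoiding hy')

theorem BruhatEdge.from_mul_simple (hM : M.IsThreeComplete) (hv : v ∈ cs.avoiding i)
    (hx : x ∈ cs.avoiding i) (hx1 : x ≠ 1)
    (h : cs.BruhatEdge (x * cs.simple i) w)
    (hw : cs.BruhatLE w (cs.simple i * v * cs.simple i)) :
    w = cs.simple i * x * cs.simple i ∨ ∃ y, cs.BruhatLE y v ∧ w = y * cs.simple i := by
  obtain ⟨y, hy, rfl | rfl | rfl | rfl⟩ := hw.of_simple_mul_simple hM hv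
  · exact absurd (h.mem_avoiding hM (hy.mem_avoiding hM hv)) (mul_simple_notMem_avoiding hx)
  · rcases h.of_simple_mul hM (hy.mem_avoiding hM hv) with rfl | ⟨y', hy', e⟩
    · exact absurd (hy.mem_avoiding hM hv) (mul_simple_notMem_avoiding hx)
    · exact absurd (eq_one_of_mul_simple_eq_simple_mul hM hx hy' e) hx1
  · exact .inr ⟨y, hy, rfl⟩
  · rcases h.of_simple_mul_simple hM (hy.mem_avoiding hM hv) with e | e | ⟨y', hy', e⟩
    · exact absurd (eq_one_of_mul_simple_eq_simple_mul hM hx (hy.mem_avoiding hM hv) e) hx1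
    · rw [mul_right_cancel_iff] at e
      exact .inl (by rw [e])
    · rw [mul_right_cancel_iff] at e
      exact absurd (e ▸ hx) (simple_mul_notMem_avoiding hy')

theorem BruhatEdge.from_simple (hM : M.IsThreeComplete) (hv : v ∈ cs.avoiding i)
    (h : cs.BruhatEdge (cs.simple i) w)
    (hw : cs.BruhatLE w (cs.simple i * v * cs.simple i)) :
    ∃ y, cs.BruhatLE y v ∧ (w = cs.simple i * y ∨ (y ≠ 1 ∧ w = y * cs.simple i)) := by
  obtain ⟨y, hy, rfl | rfl | rfl | rfl⟩ := hw.of_simple_mul_simple hM hv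
  · exact absurd (h.mem_avoiding hM (hy.mem_avoiding hM hv)) (simple_notMem_avoiding i)
  · exact ⟨y, hy, .inl rfl⟩
  · refine ⟨y, hy, .inr ⟨?_, rfl⟩⟩
    rintro rfl
    rw [one_mul] at h
    exact lt_irrefl _ h.length_lt
  · exfalso
    have key : y = 1 := by
      rcases h.of_simple_mul_simple hM (hy.mem_avoiding hM hv) with e | e | ⟨y', hy', e⟩
      · rwa [left_eq_mul] at e
      · rwa [right_eq_mul] at e
      · rw [right_eq_mul] at e
        exact absurd (e ▸ one_mem _) (simple_mul_notMem_avoiding hy')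
    subst key
    simp only [mul_one, simple_mul_simple_self] at h
    exact not_bruhatEdge_one _ h

theorem bruhatEdge_simple_mul_simple_conj (hM : M.IsThreeComplete) (hx : x ∈ cs.avoiding i)
    (hx1 : x ≠ 1) : cs.BruhatEdge (cs.simple i * x) (cs.simple i * x * cs.simple i) := by
  rw [bruhatEdge_mul_simple_iff, length_simple_mul_simple_of_mem_avoiding hM hx hx1,
    length_simple_mul_of_mem_avoiding hM hx]
  omega

theorem bruhatEdge_mul_simple_simple_conj (hM : M.IsThreeComplete) (hx : x ∈ cs.avoiding i)
    (hx1 : x ≠ 1) : cs.BruhatEdge (x * cs.simple i) (cs.simple i * x * cs.simple i) := by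
  refine ⟨_, cs.isReflection_simple i, by rw [mul_assoc], ?_⟩
  rw [length_simple_mul_simple_of_mem_avoiding hM hx hx1, length_mul_simple_of_mem_avoiding hM hx]
  omega

end Edges

theorem BruhatEdge.ne_one {x y : W} (h : cs.BruhatEdge x y) : y ≠ 1 := by
  rintro rfl
  exact not_bruhatEdge_one _ h

theorem BruhatEdge.label_mem_avoiding (hM : M.IsThreeComplete) {i : B} {v x y : W}
    (hv : v ∈ cs.avoiding i) (h : cs.BruhatEdge x y)
    (hy : cs.BruhatLE y v) : x⁻¹ * y ∈ cs.avoiding i :=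
  mul_mem (inv_mem (h.mem_avoiding hM (hy.mem_avoiding hM hv))) (hy.mem_avoiding hM hv)

variable [Finite B]

variable (cs) in
theorem finite_bruhatIic (v : W) : {x : W | cs.BruhatLE x v}.Finite :=
  (cs.finite_length_le (cs.length v)).subset fun _ h => BruhatLE.length_le cs h

variable (cs) in
/-- The elements below `v` in the Bruhat order. -/
def bruhatIic (v : W) : Finset W := (cs.finite_bruhatIic v).toFinset

@[simp]
theorem mem_bruhatIic {v x : W} : x ∈ cs.bruhatIic v ↔ cs.BruhatLE x v := by
  simp [bruhatIic]

/-- Unrolls a recursion along edges: z is the vertex where a path leaves the current copy of W_J,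
and `g z` is the contribution of what follows. `P` is an invariant of the label and the vertex
reached. -/
theorem eq_sum_labelSum_mul {prec : W → W → Prop} {v : W} {F : W → W → Poly} {g : W → Poly}
    {P : W → W → Prop}
    (hP : ∀ t x y, P t x → cs.BruhatEdge x y → cs.BruhatLE y v → P (x⁻¹ * y) y)
    (hF : ∀ t x, P t x → cs.BruhatLE x v → F t x = g x + ∑ y ∈ cs.bruhatIic v,
      if cs.BruhatEdge x y then (if prec t (x⁻¹ * y) then a else b) * F (x⁻¹ * y) y else 0)
    {t x : W} (h : P t x) (hx : cs.BruhatLE x v) :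
    F t x = ∑ z ∈ cs.bruhatIic v, cs.labelSum prec t x z * g z := by
  induction x using cs.bruhat_induction (cs.length v) generalizing t with
  | _ x ih =>
  have hR : ∀ z ∈ cs.bruhatIic v, cs.labelSum prec t x z * g z =
      (if x = z then g z else 0) + ∑ y ∈ cs.bruhatIic v, if cs.BruhatEdge x y then
        (if prec t (x⁻¹ * y) then a else b) * (cs.labelSum prec (x⁻¹ * y) y z * g z) else 0 := by
    intro z hz
    rw [cs.labelSum_eq prec t x z (cs.bruhatIic v) fun y _ hyz =>
      mem_bruhatIic.2 (hyz.trans (mem_bruhatIic.1 hz)), add_mul, Finset.sum_mul]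
    congr 1
    · split_ifs <;> simp
    · refine Finset.sum_congr rfl fun y _ => ?_
      rw [ite_mul (cs.BruhatEdge x y), zero_mul, mul_assoc]
  rw [hF t x h hx, Finset.sum_congr rfl hR, Finset.sum_add_distrib, Finset.sum_ite_eq,
    if_pos (mem_bruhatIic.2 hx), Finset.sum_comm]
  congr 1
  refine Finset.sum_congr rfl fun y hy => ?_
  rw [mem_bruhatIic] at hy
  by_cases h1 : cs.BruhatEdge x y
  · simp only [if_pos h1]
    rw [ih y h1 (BruhatLE.length_le cs hy) (hP t x y h h1 hy) hy, Finset.mul_sum]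
  · simp [h1]

/-! ### Path sums in the three copies of W_J -/

section PathSums

variable {i : B} {prec : W → W → Prop} {v : W}

theorem labelSum_conj_eq (hM : M.IsThreeComplete) (hv : v ∈ cs.avoiding i) (t : W) {x : W}
    (hx : cs.BruhatLE x v) (hx1 : x ≠ 1) :
    cs.labelSum prec t (cs.simple i * x * cs.simple i) (cs.simple i * v * cs.simple i) =
      (if x = v then 1 else 0) + ∑ y ∈ cs.bruhatIic v, if cs.BruhatEdge x y then
        (if prec t (cs.simple i * (x⁻¹ * y) * cs.simple i) then a else b) *
          cs.labelSum prec (cs.simple i * (x⁻¹ * y) * cs.simple i)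
            (cs.simple i * y * cs.simple i) (cs.simple i * v * cs.simple i) else 0 := by
  have hxV := hx.mem_avoiding hM hv
  rw [cs.labelSum_eq prec t _ _ ((cs.bruhatIic v).map
    ⟨_, simple_conj_injective (cs := cs) i⟩), Finset.sum_map]
  · congr 1
    · simp
    refine Finset.sum_congr rfl fun y hy => ?_
    have hyV := (mem_bruhatIic.1 hy).mem_avoiding hM hv
    have e : (cs.simple i * x * cs.simple i)⁻¹ * (cs.simple i * y * cs.simple i) =
        cs.simple i * (x⁻¹ * y) * cs.simple i := by simp [mul_assoc]
    simp only [Function.Embedding.coeFn_mk, e]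
    by_cases hy1 : y = 1
    · subst hy1
      rw [if_neg (not_bruhatEdge_one x), if_neg]
      simpa using not_bruhatEdge_one _
    · simp only [bruhatEdge_simple_conj_iff hM hxV hyV hx1 hy1]
  · intro w h hw
    obtain ⟨y, hy, rfl⟩ := h.from_simple_conj hM hv hxV hx1 hw
    exact Finset.mem_map.2 ⟨y, mem_bruhatIic.2 hy, rfl⟩

theorem IsAdapted.labelSum_conj_conj (hM : M.IsThreeComplete) (hp : cs.IsAdapted i prec)
    (hv : v ∈ cs.avoiding i) {t x : W} (hx : cs.BruhatLE x v) (hx1 : x ≠ 1)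
    (ht : t ∈ cs.avoiding i) (hr : cs.IsReflection t) :
    cs.labelSum prec (cs.simple i * t * cs.simple i) (cs.simple i * x * cs.simple i)
      (cs.simple i * v * cs.simple i) = cs.labelSum prec t x v := by
  induction x using cs.bruhat_induction (cs.length v) generalizing t with
  | _ x ih =>
  rw [labelSum_conj_eq hM hv _ hx hx1,
    cs.labelSum_eq prec t x v (cs.bruhatIic v) fun y _ h => mem_bruhatIic.2 h]
  congr 1
  refine Finset.sum_congr rfl fun y hy => ?_
  rw [mem_bruhatIic] at hy
  by_cases h1 : cs.BruhatEdge x y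
  · have h2 := h1.label_mem_avoiding hM hv hy
    rw [if_pos h1, if_pos h1, ih y h1 (BruhatLE.length_le cs hy) hy h1.ne_one h2 h1.isReflection]
    simp only [hp.conj_iff t ht _ h2 hr h1.isReflection]
  · rw [if_neg h1, if_neg h1]

/-- This is the part of a path after its crossing. The crossing label compares in the same way with
every possible next label, so its factor `q` comes out. -/
theorem IsAdapted.labelSum_conj (hM : M.IsThreeComplete) (hp : cs.IsAdapted i prec)
    (hv : v ∈ cs.avoiding i) {t x : W} (hx : cs.BruhatLE x v) (hx1 : x ≠ 1) {q : Poly}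
    (hq : ∀ t' ∈ cs.avoiding i, cs.IsReflection t' →
      (if prec t (cs.simple i * t' * cs.simple i) then a else b) = q) :
    cs.labelSum prec t (cs.simple i * x * cs.simple i)
      (cs.simple i * v * cs.simple i) = if x = v then 1 else q * cs.completeCDIndex prec x v := by
  have h0 : cs.labelSum prec t (cs.simple i * x * cs.simple i) (cs.simple i * v * cs.simple i) =
      (if x = v then 1 else 0) + q * ∑ y ∈ cs.bruhatIic v, if cs.BruhatEdge x y then
        cs.labelSum prec (x⁻¹ * y) y v else 0 := by
    rw [labelSum_conj_eq hM hv _ hx hx1, Finset.mul_sum]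
    congr 1
    refine Finset.sum_congr rfl fun y hy => ?_
    rw [mem_bruhatIic] at hy
    by_cases h1 : cs.BruhatEdge x y
    · have h2 := h1.label_mem_avoiding hM hv hy
      rw [if_pos h1, if_pos h1, hp.labelSum_conj_conj hM hv hy h1.ne_one h2 h1.isReflection,
        hq _ h2 h1.isReflection]
    · rw [if_neg h1, if_neg h1, mul_zero]
  have h3 := cs.completeCDIndex_eq prec x v (cs.bruhatIic v) fun y _ h => mem_bruhatIic.2 h
  rw [h0]
  by_cases hxv : x = v
  · subst hxv
    rw [completeCDIndex_self, if_pos rfl, left_eq_add] at h3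
    rw [h3, if_pos rfl, if_pos rfl, mul_zero, add_zero]
  · rw [if_neg hxv, zero_add] at h3
    rw [if_neg hxv, if_neg hxv, h3, zero_add]

/-- The path runs through sW_J with the labels of a path in W_J until it crosses at some z with
label s. All labels before the crossing precede s, which gives a; no label after it succeeds s,
which gives b. -/
theorem IsAdapted.labelSum_simple_mul (hM : M.IsThreeComplete) (hp : cs.IsAdapted i prec)
    (hv : v ∈ cs.avoiding i) {t x : W} (hx : cs.BruhatLE x v) (hx1 : x ≠ 1)
    (ht : t ∈ cs.avoiding i) (hr : cs.IsReflection t) :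
    cs.labelSum prec t (cs.simple i * x) (cs.simple i * v * cs.simple i) =
      ∑ z ∈ cs.bruhatIic v, cs.labelSum prec t x z *
        (a * if z = v then 1 else b * cs.completeCDIndex prec z v) := by
  refine eq_sum_labelSum_mul
    (F := fun t x => cs.labelSum prec t (cs.simple i * x) (cs.simple i * v * cs.simple i))
    (g := fun z => a * if z = v then 1 else b * cs.completeCDIndex prec z v)
    (P := fun t x => x ≠ 1 ∧ t ∈ cs.avoiding i ∧ cs.IsReflection t)
    (fun t x y _ h hy => ⟨h.ne_one, h.label_mem_avoiding hM hv hy, h.isReflection⟩) ?_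
    ⟨hx1, ht, hr⟩ hx
  rintro t x ⟨hx1, ht, hr⟩ hx
  have hxV := hx.mem_avoiding hM hv
  have hn : cs.simple i * x * cs.simple i ∉ (cs.bruhatIic v).map
      (mulLeftEmbedding (cs.simple i)) := by
    simp only [Finset.mem_map, mem_bruhatIic, mulLeftEmbedding_apply, mul_assoc,
      mul_right_inj, exists_eq_right]
    exact fun h => mul_simple_notMem_avoiding hxV (h.mem_avoiding hM hv)
  rw [cs.labelSum_eq prec t _ _ (insert (cs.simple i * x * cs.simple i)
    ((cs.bruhatIic v).map (mulLeftEmbedding (cs.simple i)))), Finset.sum_insert hn, Finset.sum_map,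
    if_pos (bruhatEdge_simple_mul_simple_conj hM hxV hx1), inv_mul_cancel_left,
    if_pos (hp.lt_simple t ht hr), if_neg, zero_add]
  · congr 1
    · rw [hp.labelSum_conj hM hv hx hx1 fun t' ht' hr' => if_neg (hp.not_simple_lt_conj t' ht' hr')]
    · refine Finset.sum_congr rfl fun y hy => ?_
      have hyV := (mem_bruhatIic.1 hy).mem_avoiding hM hv
      have e : (cs.simple i * x)⁻¹ * (cs.simple i * y) = x⁻¹ * y := by simp [mul_assoc]
      simp only [mulLeftEmbedding_apply, e, bruhatEdge_simple_mul_iff hM hxV hyV]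
  · rw [mul_assoc, mul_right_inj]
    rintro rfl
    exact mul_simple_notMem_avoiding hv hxV
  · intro w h hw
    rcases h.from_simple_mul hM hv hxV hx1 hw with rfl | ⟨y, hy, rfl⟩
    · simp
    · exact Finset.mem_insert_of_mem (by simpa using hy)

/-- On the side W_J s the crossing label precedes the conjugates sts before and after it, so the
order of the two factors is reversed: b, then a. -/
theorem IsAdapted.labelSum_mul_simple (hM : M.IsThreeComplete) (hp : cs.IsAdapted i prec)
    (hv : v ∈ cs.avoiding i) {t x : W} (hx : cs.BruhatLE x v) (hx1 : x ≠ 1)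
    (ht : t ∈ cs.avoiding i) (hr : cs.IsReflection t) :
    cs.labelSum prec (cs.simple i * t * cs.simple i) (x * cs.simple i)
        (cs.simple i * v * cs.simple i) =
      ∑ z ∈ cs.bruhatIic v, cs.labelSum prec t x z *
        (b * if z = v then 1 else a * cs.completeCDIndex prec z v) := by
  refine eq_sum_labelSum_mul
    (F := fun t x => cs.labelSum prec (cs.simple i * t * cs.simple i) (x * cs.simple i)
      (cs.simple i * v * cs.simple i))
    (g := fun z => b * if z = v then 1 else a * cs.completeCDIndex prec z v)
    (P := fun t x => x ≠ 1 ∧ t ∈ cs.avoiding i ∧ cs.IsReflection t)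
    (fun t x y _ h hy => ⟨h.ne_one, h.label_mem_avoiding hM hv hy, h.isReflection⟩) ?_
    ⟨hx1, ht, hr⟩ hx
  rintro t x ⟨hx1, ht, hr⟩ hx
  have hxV := hx.mem_avoiding hM hv
  have hn : cs.simple i * x * cs.simple i ∉ (cs.bruhatIic v).map
      (mulRightEmbedding (cs.simple i)) := by
    simp only [Finset.mem_map, mem_bruhatIic, mulRightEmbedding_apply, mul_left_inj,
      exists_eq_right]
    exact fun h => simple_mul_notMem_avoiding hxV (h.mem_avoiding hM hv)
  have e0 : (x * cs.simple i)⁻¹ * (cs.simple i * x * cs.simple i) =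
      cs.simple i * (x⁻¹ * cs.simple i * x) * cs.simple i := by simp [mul_assoc]
  rw [cs.labelSum_eq prec _ _ _ (insert (cs.simple i * x * cs.simple i)
    ((cs.bruhatIic v).map (mulRightEmbedding (cs.simple i)))), Finset.sum_insert hn, Finset.sum_map,
    if_pos (bruhatEdge_mul_simple_simple_conj hM hxV hx1), e0,
    if_neg (hp.not_conj_lt x hxV hx1 t ht hr), if_neg, zero_add]
  · congr 1
    · rw [hp.labelSum_conj hM hv hx hx1 fun t' ht' hr' =>
        if_pos (hp.lt_conj x hxV hx1 t' ht' hr')]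
    · refine Finset.sum_congr rfl fun y hy => ?_
      have hyV := (mem_bruhatIic.1 hy).mem_avoiding hM hv
      have e : (x * cs.simple i)⁻¹ * (y * cs.simple i) =
        cs.simple i * (x⁻¹ * y) * cs.simple i := by simp [mul_assoc]
      simp only [mulRightEmbedding_apply, e, bruhatEdge_mul_simple_mul_simple_iff hM hxV hyV]
      by_cases h1 : cs.BruhatEdge x y
      · simp only [if_pos h1, hp.conj_iff t ht _
          (h1.label_mem_avoiding hM hv (mem_bruhatIic.1 hy)) hr h1.isReflection]
      · rw [if_neg h1, if_neg h1]
  · rw [mul_left_inj]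
    rintro rfl
    exact simple_mul_notMem_avoiding hv hxV
  · intro w h hw
    rcases h.from_mul_simple hM hv hxV hx1 hw with rfl | ⟨y, hy, rfl⟩
    · simp
    · exact Finset.mem_insert_of_mem (by simpa using hy)

theorem IsAdapted.completeCDIndex_simple (hM : M.IsThreeComplete) (hp : cs.IsAdapted i prec)
    (hv : v ∈ cs.avoiding i) (hv1 : v ≠ 1) :
    cs.completeCDIndex prec (cs.simple i) (cs.simple i * v * cs.simple i) =
      cs.completeCDIndex prec 1 v * c + ∑ x ∈ cs.bruhatIoo 1 v,
        cs.completeCDIndex prec 1 x * d * cs.completeCDIndex prec x v := by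
  set G : W → Poly := fun z => if z = v then c else d * cs.completeCDIndex prec z v with hG
  have hsum : cs.completeCDIndex prec (cs.simple i) (cs.simple i * v * cs.simple i) =
      ∑ y ∈ cs.bruhatIic v, if cs.BruhatEdge 1 y then
        ∑ z ∈ cs.bruhatIic v, cs.labelSum prec y y z * G z else 0 := by
    have hdisj : Disjoint ((cs.bruhatIic v).map (mulLeftEmbedding (cs.simple i)))
        (((cs.bruhatIic v).erase 1).map (mulRightEmbedding (cs.simple i))) := by
      rw [Finset.disjoint_left]
      intro w h h'
      simp only [Finset.mem_map, mem_bruhatIic, mulLeftEmbedding_apply, mulRightEmbedding_apply,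
        Finset.mem_erase] at h h'
      obtain ⟨y, hy, rfl⟩ := h
      obtain ⟨y', ⟨hy1, hy'⟩, e⟩ := h'
      exact hy1 (eq_one_of_mul_simple_eq_simple_mul hM (hy'.mem_avoiding hM hv)
        (hy.mem_avoiding hM hv) e)
    -- Since s·e = e·s, the second copy omits e. The term of e vanishes, so it can be restored
    -- before the two sums are merged.
    rw [cs.completeCDIndex_eq prec _ _ _ ?_, Finset.sum_union hdisj, Finset.sum_map, Finset.sum_map,
      Finset.sum_erase, if_neg, zero_add, ← Finset.sum_add_distrib]
    · refine Finset.sum_congr rfl fun y hy => ?_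
      rw [mem_bruhatIic] at hy
      have hyV := hy.mem_avoiding hM hv
      have e1 := bruhatEdge_simple_mul_iff hM (one_mem (cs.avoiding i)) hyV
      have e2 := bruhatEdge_mul_simple_mul_simple_iff hM (one_mem (cs.avoiding i)) hyV
      rw [mul_one] at e1
      rw [one_mul] at e2
      simp only [mulLeftEmbedding_apply, mulRightEmbedding_apply, e1, e2, inv_simple,
        simple_mul_simple_cancel_left]
      by_cases h1 : cs.BruhatEdge 1 y
      · have h2 : cs.IsReflection y := by simpa using h1.isReflection
        rw [if_pos h1, if_pos h1, if_pos h1, hp.labelSum_simple_mul hM hv hy h1.ne_one hyV h2,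
          ← mul_assoc, hp.labelSum_mul_simple hM hv hy h1.ne_one hyV h2, ← Finset.sum_add_distrib]
        refine Finset.sum_congr rfl fun z _ => ?_
        rw [← mul_add, hG]
        congr 1
        by_cases hz : z = v
        · simp [hz, c]
        · simp only [if_neg hz, d, add_mul, mul_assoc]
      · simp [h1]
    · intro h
      rw [right_eq_mul] at h
      exact simple_mul_notMem_avoiding hv (h ▸ one_mem _)
    · rw [mulRightEmbedding_apply, one_mul]
      exact if_neg fun h => lt_irrefl _ h.length_lt
    · intro w h hw
      obtain ⟨y, hy, rfl | ⟨hy1, rfl⟩⟩ := h.from_simple hM hv hw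
      · exact Finset.mem_union_left _ (by simpa using hy)
      · exact Finset.mem_union_right _ (by simpa using ⟨hy1, hy⟩)
  -- Collecting the first edges e → y gives the index of [e, z], except at z = e, where the trivial
  -- path has no first edge. Thus no crossing occurs at e.
  have hterm : ∀ z ∈ cs.bruhatIic v, (∑ y ∈ cs.bruhatIic v, if cs.BruhatEdge 1 y then
      cs.labelSum prec y y z * G z else 0) =
      if z = 1 then 0 else cs.completeCDIndex prec 1 z * G z := by
    intro z hz
    have h1 := cs.completeCDIndex_eq prec 1 z (cs.bruhatIic v) fun y _ hyz =>
      mem_bruhatIic.2 (hyz.trans (mem_bruhatIic.1 hz))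
    simp only [inv_one, one_mul] at h1
    have h2 : (∑ y ∈ cs.bruhatIic v, if cs.BruhatEdge 1 y then
        cs.labelSum prec y y z * G z else 0) = (∑ y ∈ cs.bruhatIic v, if cs.BruhatEdge 1 y then
        cs.labelSum prec y y z else 0) * G z := by
      simp only [Finset.sum_mul, ite_mul, zero_mul]
    rw [h2]
    by_cases hz1 : z = 1
    · subst hz1
      rw [completeCDIndex_self, if_pos rfl, left_eq_add] at h1
      rw [h1, if_pos rfl, zero_mul]
    · rw [if_neg (Ne.symm hz1), zero_add] at h1
      rw [if_neg hz1, h1]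
  have hIic : (cs.bruhatIic v).erase 1 = insert v (cs.bruhatIoo 1 v) := by
    ext z
    simp only [Finset.mem_erase, mem_bruhatIic, Finset.mem_insert, mem_bruhatIoo, BruhatLT,
      one_bruhatLE, true_and]
    constructor
    · rintro ⟨h1, h2⟩
      by_cases h3 : z = v
      · exact .inl h3
      · exact .inr ⟨h1.symm, h2, h3⟩
    · rintro (rfl | ⟨h1, h2, -⟩)
      · exact ⟨hv1, .refl⟩
      · exact ⟨h1.symm, h2⟩
  have hnv : v ∉ cs.bruhatIoo 1 v := fun h => (cs.mem_bruhatIoo.1 h).2.2 rfl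
  calc _ = ∑ z ∈ cs.bruhatIic v, if z = 1 then 0 else cs.completeCDIndex prec 1 z * G z := by
        rw [hsum, ← Finset.sum_congr rfl hterm, Finset.sum_comm]
        refine Finset.sum_congr rfl fun y _ => ?_
        split_ifs <;> simp
    _ = ∑ z ∈ (cs.bruhatIic v).erase 1, cs.completeCDIndex prec 1 z * G z := by
        rw [← Finset.sum_erase (s := cs.bruhatIic v) (a := 1)
          (f := fun z => if z = 1 then 0 else cs.completeCDIndex prec 1 z * G z) (if_pos rfl)]
        exact Finset.sum_congr rfl fun z hz => if_neg (Finset.ne_of_mem_erase hz)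
    _ = _ := by
        rw [hIic, Finset.sum_insert hnv, hG]
        simp only [if_true]
        congr 1
        refine Finset.sum_congr rfl fun z hz => ?_
        rw [if_neg (by rintro rfl; exact hnv hz), mul_assoc]

end PathSums

end CoxeterSystem
end

theorem theorem6 {B W : Type*} [Finite B] [Group W] {M : CoxeterMatrix B}
    (cs : CoxeterSystem M W) (hM : M.IsThreeComplete) (v : W) (hv : v ≠ 1) (i : B)
    (hs : ¬ cs.BruhatLE (cs.simple i) v) :
    (∃ prec : W → W → Prop, cs.IsReflectionOrdering prec) ∧
    ∀ prec : W → W → W → W → Prop, (∀ x y : W, cs.IsReflectionOrdering (prec x y)) →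
      cs.completeCDIndex (prec (cs.simple i) (cs.simple i * v * cs.simple i))
          (cs.simple i) (cs.simple i * v * cs.simple i) =
        cs.completeCDIndex (prec 1 v) 1 v * CompleteCD.c +
          ∑ x ∈ cs.bruhatIoo 1 v,
            cs.completeCDIndex (prec 1 x) 1 x * CompleteCD.d *
              cs.completeCDIndex (prec x v) x v := by
  obtain ⟨m, ⟨e⟩⟩ := Finite.exists_equiv_fin B
  obtain ⟨m, rfl⟩ : ∃ n, m = n + 1 := Nat.exists_eq_succ_of_ne_zero (by
    rintro rfl
    exact (e i).elim0)
  -- The enumeration starts with s, so that the coordinate of α_s decides first.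
  obtain ⟨e, he⟩ : ∃ e : B ≃ Fin (m + 1), e i = 0 :=
    ⟨e.trans (Equiv.swap (e i) 0), by simp⟩
  have hlex := CoxeterSystem.isReflectionOrdering_lexPrec (cs := cs) hM e
  refine ⟨⟨_, hlex⟩, fun prec hprec => ?_⟩
  have key := fun x y => CoxeterSystem.completeCDIndex_independent hM (hprec x y) hlex x y
  simp only [key]
  exact (CoxeterSystem.isAdapted_lexPrec hM he).completeCDIndex_simple hM
    (CoxeterSystem.mem_avoiding_of_not_bruhatLE hM hs) hv
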